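/- For $\lambda>0$, $\nu>0$ and $x>0$ let \[ \mathcal W^-_{\lambda,\nu}(x)=\Bigl(\frac x2\Bigr)^{\nu}\sum_{n=0}^\infty\frac{(-1)^n (x/2)^{(\lambda+1)n}}{n!\,\Gamma(\lambda n+\nu+1)}, \] and for $a>0$ let $h(u)=\tfrac12(e^u-e^{-\lambda u})-au$ $(u\in\mathbb C)$; a saddle is a zero of $h'$. Suppose that $\lambda>0$ and that $(a,\lambda)$ lies below the double-saddle curve, that is, \[ 0<a<\frac{1+\lambda}{2}\,\lambda^{(1-\lambda)/(1+\lambda)} . \] Then there is exactly one saddle $u_0$ with $0<\operatorname{Im}u_0\le\pi$ such that every saddle $v$ with $|\operatorname{Im}v|\le\pi$ satisfies $|\operatorname{Im}v|\ge\operatorname{Im}u_0$; so there is no real saddle, and $u_0,\overline{u_0}$ is the pair of complex-conjugate saddles of the strip $|\operatorname{Im}u|\le\pi$ nearest to the real axis. Put $h_0''=h''(u_0)$. Then $h_0''\neq0$. There is a function $u(w)$, analytic near $w=0$, with \[ -\tfrac12w^2=h(u(w))-h(u_0),\qquad u(0)=u_0,\qquad u'(0)=\frac1{\sqrt{-h_0''}},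 \] and with $A_k$ $(k\ge0)$ denoting the complex numbers for which the even part of the Taylor series of $du/dw$ at $w=0$ is $\frac{1}{\sqrt{-h_0''}}\sum_{k\ge0}(-1)^kA_kw^{2k}$, one has \[ \mathcal W^-_{\lambda,\nu}(x)\sim\sqrt{\frac{2}{\pi x}}\;\operatorname{Re}\Bigl\{\frac{e^{xh(u_0)}}{\sqrt{h_0''}}\sum_{k\ge0}\frac{(-1)^k(\frac12)_kA_k}{(x/2)^k}\Bigr\}\qquad(x\to+\infty,\ \nu=ax). \] Here square roots are principal, $(\frac12)_k$ is the Pochhammer symbol, and $\sim$ means that for every integer $N\ge0$, as $x\to+\infty$ with $a,\lambda$ fixed, \[ \mathcal W^-_{\lambda,ax}(x)=\sqrt{\frac{2}{\pi x}}\;\operatorname{Re}\Bigl\{\frac{e^{xh(u_0)}}{\sqrt{h_0''}}\sum_{k=0}^{N-1}\frac{(-1)^k(\frac12)_kA_k}{(x/2)^k}\Bigr\}+O\bigl(e^{x\operatorname{Re}h(u_0)}\,x^{-N-1/2}\bigr). \] -/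

import Mathlib

open Filter Topology Asymptotics

/-- The Wright function `W_{λ,μ}(z) = ∑ zⁿ / (n! Γ(λ n + μ))` for real parameters and argument. -/
noncomputable def wright (lam mu z : ℝ) : ℝ :=
  ∑' n : ℕ, z ^ n / ((n.factorial : ℝ) * Real.Gamma (lam * n + mu))

/-- For `λ > 0` the series that defines the Wright function converges (absolutely), so that
the sum in `wright` is the actual sum of the series. -/
theorem summable_wright {lam : ℝ} (hlam : 0 < lam) (mu z : ℝ) :
    Summable fun n : ℕ => z ^ n / ((n.factorial : ℝ) * Real.Gamma (lam * n + mu)) := by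
  have hlim : Tendsto (fun n : ℕ => lam * (n : ℝ) + mu) atTop atTop :=
    tendsto_atTop_add_const_right _ _ (tendsto_natCast_atTop_atTop.const_mul_atTop hlam)
  refine (Real.summable_pow_div_factorial |z|).of_norm_bounded_eventually_nat ?_
  filter_upwards [hlim.eventually_ge_atTop 2] with n hn
  have hG : 1 ≤ Real.Gamma (lam * n + mu) := by
    have h := Real.Gamma_strictMonoOn_Ici.monotoneOn (Set.mem_Ici.2 le_rfl) (Set.mem_Ici.2 hn) hn
    rwa [Real.Gamma_two] at h
  have hf : (0 : ℝ) < n.factorial := by exact_mod_cast n.factorial_pos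
  rw [norm_div, norm_pow, Real.norm_eq_abs, Real.norm_of_nonneg (by positivity)]
  exact div_le_div_of_nonneg_left (by positivity) hf (by nlinarith)

/-- `𝒲⁻_{λ,ν}(x) = (x/2)^ν W_{λ,ν+1}(-(x/2)^{λ+1})`, for `x > 0`. -/
noncomputable def wrightMinus (lam nu x : ℝ) : ℝ :=
  (x / 2) ^ nu * wright lam (nu + 1) (-(x / 2) ^ (lam + 1))

/-- The phase function `h(u) = (e^u - e^{-λu})/2 - a u`. -/
noncomputable def phase (lam a : ℝ) (u : ℂ) : ℂ :=
  (Complex.exp u - Complex.exp (-(lam : ℂ) * u)) / 2 - (a : ℂ) * u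

/-- A saddle point of the phase: a zero of `h'`. -/
def IsSaddle (lam a : ℝ) (u : ℂ) : Prop :=
  deriv (phase lam a) u = 0

/-- `u₀` is the upper member of the complex-conjugate pair of saddles of the strip `|Im u| ≤ π`
that lies nearest to the real axis: it is a saddle with `0 < Im u₀ ≤ π`, and no saddle of the strip
(in particular no real one) is closer to the real axis. -/
structure IsUpperSaddle (lam a : ℝ) (u₀ : ℂ) : Prop where
  saddle : IsSaddle lam a u₀
  im_pos : 0 < u₀.im
  im_le : u₀.im ≤ Real.pi
  nearest : ∀ v : ℂ, IsSaddle lam a v → |v.im| ≤ Real.pi → u₀.im ≤ |v.im|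

/-- `h₀'' = h''(u₀)`. -/
noncomputable def phaseSecond (lam a : ℝ) (u₀ : ℂ) : ℂ :=
  iteratedDeriv 2 (phase lam a) u₀

/-- `u = φ(w)` is the local inversion at `w = 0` of the change of variable
`-w²/2 = h(u) - h(u₀)`, with `u - u₀ = w / √(-h₀'') + O(w²)`. -/
structure IsSaddleInversion (lam a : ℝ) (u₀ : ℂ) (φ : ℂ → ℂ) : Prop where
  analytic : AnalyticAt ℂ φ 0
  map_zero : φ 0 = u₀
  deriv_zero : deriv φ 0 = 1 / Complex.sqrt (-phaseSecond lam a u₀)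
  phase_eq : ∀ᶠ w in 𝓝 (0 : ℂ), -(w ^ 2 / 2) = phase lam a (φ w) - phase lam a u₀

/-- The coefficient `A_k`, where the even part of the Taylor series of `du/dw` at `w = 0` is
`(1 / √(-h₀'')) ∑ (-1)^k A_k w^{2k}`. -/
noncomputable def saddleCoeff (lam a : ℝ) (u₀ : ℂ) (φ : ℂ → ℂ) (k : ℕ) : ℂ :=
  (-1) ^ k * Complex.sqrt (-phaseSecond lam a u₀) *
    (iteratedDeriv (2 * k) (deriv φ) 0 / ((2 * k).factorial : ℂ))

/-- The first `N` terms of the series `∑ (-1)^k (1/2)_k A_k (x/2)^{-k}`. -/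
noncomputable def saddlePartialSum (A : ℕ → ℂ) (N : ℕ) (x : ℝ) : ℂ :=
  ∑ k ∈ Finset.range N,
    (-1) ^ k * (ascPochhammer ℂ k).eval (1 / 2) * A k / ((x : ℂ) / 2) ^ k

/-!
Along the contour that comes in along `Im u = -π`, crosses to `Im u = π` and goes out again,
Hankel's formula represents the reciprocal Gamma function, and summing over the series turns
`𝒲⁻_{λ,ax}(x)` into the integral of `exp (x h)`. By conjugation symmetry only the upper half of the
contour matters: `𝒲⁻_{λ,ax}(x)` is `1 / π` times the imaginary part of the integral of `exp (x h)`
over the hook that climbs from the real axis to `Im u = π` and then runs to infinity.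

The equation `Im h' = 0` cuts out a graph over `Im u` in the strip `0 < Im u < π / (1 + λ)`, along
which `Re h'` decreases strictly; it starts positive exactly when `(a, λ)` lies below the
double-saddle curve, and ends at `-a`. So there is one saddle `u₀` in this strip.

The hook is deformed to the diagonal `u₀ + t (1 + i)`, on which `Re h` is strictly concave because
`Im h'' > 0`, followed by a hook on which `Re h` stays below `Re h(u₀)`. Only a neighbourhood of
`u₀` contributes; there the Morse coordinate `w` turns the integral into a Gaussian one of `du/dw`,
and the even Gaussian moments give the coefficients. The imaginary part becomes the real part of the
theorem because `√h₀'' = i √(-h₀'')`.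
-/

section ContourIntegrals

open MeasureTheory Set
open Complex (I)
open scoped Real

/-- The integral of `f` along the vertical segment from `z` to the line `Im u = π`, followed by the
horizontal ray to `∞ + iπ`. For real `z` the path is the upper half of Hankel's loop. -/
noncomputable def hookIntegral (f : ℂ → ℂ) (z : ℂ) : ℂ :=
  (∫ q in z.im..π, f (z.re + q * I) * I) + ∫ p in Ioi z.re, f (p + π * I)

variable {f F : ℂ → ℂ}

theorem hookIntegral_const_mul (c : ℂ) (f : ℂ → ℂ) (z : ℂ) :
    hookIntegral (fun u => c * f u) z = c * hookIntegral f z := by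
  simp only [hookIntegral, mul_assoc, intervalIntegral.integral_const_mul, integral_const_mul,
    mul_add]

theorem hookIntegral_comp_add_ofReal (f : ℂ → ℂ) (z : ℂ) (L : ℝ) :
    hookIntegral (fun u => f (u + L)) z = hookIntegral f (z + L) := by
  have hray := (measurePreserving_add_right volume L).setIntegral_preimage_emb
    (measurableEmbedding_addRight L) (fun p : ℝ => f (p + π * I)) (Ioi (z.re + L))
  simp only [preimage_add_const_Ioi, add_sub_cancel_right] at hray
  simp only [hookIntegral, Complex.add_re, Complex.ofReal_re, Complex.add_im, Complex.ofReal_im,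
    add_zero, ← hray, Complex.ofReal_add, add_right_comm]

theorem hasDerivAt_comp_line {f' u d : ℂ} {t : ℝ} (hf : HasDerivAt f f' (u + t * d)) :
    HasDerivAt (fun t : ℝ => f (u + t * d)) (f' * d) t := by
  have hline : HasDerivAt (fun t : ℝ => u + (t : ℂ) * d) d t := by
    simpa using ((Complex.ofRealCLM.hasDerivAt (x := t)).mul_const d).const_add u
  exact hf.comp t hline

theorem integral_line_eq_sub (hF : ∀ z, HasDerivAt F (f z) z) (hf : Continuous f)
    (u d : ℂ) (a b : ℝ) :
    ∫ t in a..b, f (u + t * d) * d = F (u + b * d) - F (u + a * d) :=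
  intervalIntegral.integral_eq_sub_of_hasDerivAt (fun _ _ => hasDerivAt_comp_line (hF _))
    (Continuous.intervalIntegrable (by fun_prop) _ _)

theorem tendsto_primitive_atTop_add_pi_mul_I (hF : ∀ z, HasDerivAt F (f z) z) (hf : Continuous f)
    {z : ℂ} (hray : IntegrableOn (fun p : ℝ => f (p + π * I)) (Ioi z.re)) :
    Tendsto (fun p : ℝ => F (p + π * I)) atTop (𝓝 (F z + hookIntegral f z)) := by
  have hvertical := integral_line_eq_sub hF hf z.re I z.im π
  rw [Complex.re_add_im] at hvertical
  have hlim := (intervalIntegral_tendsto_integral_Ioi z.re hray tendsto_id).const_add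
    (F (z.re + π * I))
  rw [hookIntegral, hvertical, ← add_assoc, add_sub_cancel]
  refine hlim.congr fun p => ?_
  have hhorizontal := integral_line_eq_sub hF hf (π * I) 1 z.re p
  simp only [mul_one, add_comm (π * I)] at hhorizontal
  simp only [id_eq, hhorizontal, add_sub_cancel]

theorem integral_segment_add_hookIntegral (hf : Differentiable ℂ f)
    (hray : ∀ P : ℝ, IntegrableOn (fun p : ℝ => f (p + π * I)) (Ioi P)) (u d : ℂ) (a b : ℝ) :
    (∫ t in a..b, f (u + t * d) * d) + hookIntegral f (u + b * d) =
      hookIntegral f (u + a * d) := by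
  obtain ⟨F, hF⟩ := hf.isExactOn_univ
  replace hF : ∀ z, HasDerivAt F (f z) z := fun z => hF z (mem_univ z)
  have hlim := fun z : ℂ => tendsto_primitive_atTop_add_pi_mul_I hF hf.continuous (hray z.re)
  have hends := tendsto_nhds_unique (hlim (u + a * d)) (hlim (u + b * d))
  rw [integral_line_eq_sub hF hf.continuous]
  linear_combination -hends

theorem im_hookIntegral_ofReal (hf : Differentiable ℂ f) (hreal : ∀ p : ℝ, (f p).im = 0)
    (hray : ∀ P : ℝ, IntegrableOn (fun p : ℝ => f (p + π * I)) (Ioi P)) (P Q : ℝ) :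
    (hookIntegral f P).im = (hookIntegral f Q).im := by
  have hsegment := integral_segment_add_hookIntegral hf hray 0 1 P Q
  simp only [zero_add, mul_one] at hsegment
  have haxis : ∫ t in P..Q, f t = ((∫ t in P..Q, (f t).re : ℝ) : ℂ) := by
    rw [← intervalIntegral.integral_ofReal]
    exact intervalIntegral.integral_congr fun t _ => Complex.ext rfl (hreal t)
  rw [← hsegment, haxis, Complex.add_im, Complex.ofReal_im, zero_add]

end ContourIntegrals

section HankelIntegral

open MeasureTheory Set
open Complex (I)
open scoped Real

theorem exp_add_pi_mul_I (p : ℝ) : Complex.exp (p + π * I) = -Real.exp p := by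
  rw [Complex.exp_add, Complex.exp_pi_mul_I]
  simp

theorem eventually_neg_mul_exp_add_mul_le_neg {y : ℝ} (hy : 0 < y) (c : ℝ) :
    ∀ᶠ p in atTop, -(y * Real.exp p) + c * p ≤ -p := by
  filter_upwards [((Real.isLittleO_pow_exp_atTop (n := 1)).const_mul_left (c + 1)).bound hy]
    with p hp
  rw [pow_one, Real.norm_eq_abs, Real.norm_of_nonneg (Real.exp_pos p).le] at hp
  linarith [le_abs_self ((c + 1) * p)]

theorem integrableOn_exp_neg_mul_exp_add_mul {y : ℝ} (hy : 0 < y) (c P : ℝ) :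
    IntegrableOn (fun p => Real.exp (-(y * Real.exp p) + c * p)) (Ioi P) := by
  refine integrable_of_isBigO_exp_neg one_pos (Continuous.continuousOn (by fun_prop))
    (IsBigO.of_bound' ?_)
  filter_upwards [eventually_neg_mul_exp_add_mul_le_neg hy c] with p hp
  rwa [Real.norm_of_nonneg (Real.exp_pos _).le, Real.norm_of_nonneg (Real.exp_pos _).le,
    Real.exp_le_exp, neg_one_mul]

theorem integrable_exp_neg_exp_add_mul_and_integral_eq {b : ℝ} (hb : 0 < b) :
    Integrable (fun p : ℝ => Real.exp (-Real.exp p + b * p)) ∧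
      ∫ p : ℝ, Real.exp (-Real.exp p + b * p) = Real.Gamma b := by
  have himage : Real.exp '' univ = Ioi 0 := by rw [image_univ, Real.range_exp]
  have hderiv : ∀ p ∈ (univ : Set ℝ), HasDerivWithinAt Real.exp (Real.exp p) univ p :=
    fun p _ => (Real.hasDerivAt_exp p).hasDerivWithinAt
  have hsubst : ∀ p : ℝ, |Real.exp p| • (Real.exp (-Real.exp p) * Real.exp p ^ (b - 1)) =
      Real.exp (-Real.exp p + b * p) := fun p => by
    rw [abs_of_pos (Real.exp_pos p), smul_eq_mul, ← Real.exp_mul, ← Real.exp_add, ← Real.exp_add]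
    ring_nf
  have hint := integrableOn_image_iff_integrableOn_abs_deriv_smul MeasurableSet.univ hderiv
    Real.exp_injective.injOn fun t => Real.exp (-t) * t ^ (b - 1)
  have hval := integral_image_eq_integral_abs_deriv_smul MeasurableSet.univ hderiv
    Real.exp_injective.injOn fun t => Real.exp (-t) * t ^ (b - 1)
  simp only [himage, hsubst, integrableOn_univ, setIntegral_univ] at hint hval
  exact ⟨hint.1 (Real.GammaIntegral_convergent hb), by rw [Real.Gamma_eq_integral hb, hval]⟩

/-- The integrand `e^t t^{-s} dt` of Hankel's integral for `1 / Γ(s)` after the substitution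
`t = e^u`. -/
noncomputable def hankelFun (s : ℝ) (u : ℂ) : ℂ := Complex.exp (Complex.exp u - (s - 1) * u)

theorem differentiable_hankelFun (s : ℝ) : Differentiable ℂ (hankelFun s) := by
  unfold hankelFun
  fun_prop

theorem hankelFun_add (s t : ℝ) (u : ℂ) :
    hankelFun (s + t) u = Complex.exp (-(t * u)) * hankelFun s u := by
  rw [hankelFun, hankelFun, ← Complex.exp_add]
  push_cast
  ring_nf

theorem im_hankelFun_ofReal (s p : ℝ) : (hankelFun s p).im = 0 := by
  have hreal : hankelFun s p = (Real.exp (Real.exp p - (s - 1) * p) : ℝ) := by simp [hankelFun]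
  rw [hreal, Complex.ofReal_im]

theorem hankelFun_add_pi_mul_I (s p : ℝ) :
    hankelFun s (p + π * I) =
      Complex.exp ((-Real.exp p + (1 - s) * p : ℝ) + ((1 - s) * π : ℝ) * I) := by
  rw [hankelFun, exp_add_pi_mul_I]
  push_cast
  ring_nf

theorem norm_hankelFun_add_pi_mul_I (s p : ℝ) :
    ‖hankelFun s (p + π * I)‖ = Real.exp (-Real.exp p + (1 - s) * p) := by
  rw [hankelFun_add_pi_mul_I, Complex.norm_exp, Complex.add_re, Complex.ofReal_re,
    Complex.re_ofReal_mul, Complex.I_re, mul_zero, add_zero]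

theorem im_hankelFun_add_pi_mul_I (s p : ℝ) :
    (hankelFun s (p + π * I)).im =
      Real.exp (-Real.exp p + (1 - s) * p) * Real.sin ((1 - s) * π) := by
  rw [hankelFun_add_pi_mul_I, Complex.exp_im, Complex.add_re, Complex.add_im, Complex.ofReal_re,
    Complex.ofReal_im, Complex.re_ofReal_mul, Complex.im_ofReal_mul, Complex.I_re, Complex.I_im,
    mul_zero, mul_one, add_zero, zero_add]

theorem norm_hankelFun_le (s : ℝ) (u : ℂ) :
    ‖hankelFun s u‖ ≤ Real.exp (Real.exp u.re + (1 - s) * u.re) := by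
  rw [hankelFun, Complex.norm_exp, Real.exp_le_exp]
  have hexp : (Complex.exp u).re ≤ Real.exp u.re :=
    (Complex.re_le_norm _).trans_eq (Complex.norm_exp u)
  have hlin : (((s : ℂ) - 1) * u).re = (s - 1) * u.re := by
    rw [← Complex.ofReal_one, ← Complex.ofReal_sub, Complex.re_ofReal_mul]
  rw [Complex.sub_re, hlin]
  linarith

theorem integrableOn_hankelFun_ray (s P : ℝ) :
    IntegrableOn (fun p : ℝ => hankelFun s (p + π * I)) (Ioi P) := by
  have hcont := (differentiable_hankelFun s).continuous
  refine Integrable.mono' (integrableOn_exp_neg_mul_exp_add_mul one_pos (1 - s) P)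
    (Continuous.aestronglyMeasurable (by fun_prop)) (Eventually.of_forall fun p => ?_)
  rw [norm_hankelFun_add_pi_mul_I, one_mul]

theorem im_hookIntegral_hankelFun_eq_add (s P : ℝ) :
    (hookIntegral (hankelFun s) P).im =
      (∫ q in (0 : ℝ)..π, hankelFun s (P + q * I)).re +
        (∫ p in Ioi P, Real.exp (-Real.exp p + (1 - s) * p)) * Real.sin ((1 - s) * π) := by
  have hray : (∫ p in Ioi P, hankelFun s (p + π * I)).im =
      ∫ p in Ioi P, (hankelFun s (p + π * I)).im :=
    (Complex.imCLM.integral_comp_comm (integrableOn_hankelFun_ray s P)).symm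
  rw [hookIntegral, Complex.add_im, Complex.ofReal_re, Complex.ofReal_im, hray,
    intervalIntegral.integral_mul_const, Complex.mul_I_im]
  simp only [im_hankelFun_add_pi_mul_I, integral_mul_const]

theorem im_hookIntegral_hankelFun_eq (s P Q : ℝ) :
    (hookIntegral (hankelFun s) P).im = (hookIntegral (hankelFun s) Q).im :=
  im_hookIntegral_ofReal (differentiable_hankelFun s) (im_hankelFun_ofReal s)
    (integrableOn_hankelFun_ray s) P Q

theorem Gamma_one_sub_mul_sin_eq_pi_div_Gamma {s : ℝ} (hs : s < 1) :
    Real.Gamma (1 - s) * Real.sin ((1 - s) * π) = π / Real.Gamma s := by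
  have hreflection := Real.Gamma_mul_Gamma_one_sub s
  have hne := (Real.Gamma_pos_of_pos (sub_pos.2 hs)).ne'
  have hsin : Real.sin ((1 - s) * π) = Real.sin (π * s) := by
    rw [← Real.sin_pi_sub]
    ring_nf
  rw [hsin]
  rcases eq_or_ne (Real.sin (π * s)) 0 with h | h
  -- Here `s` is a pole of `Γ`, where Mathlib's `Γ` and hence `π / Γ s` take the value `0`.
  · rw [h, div_zero] at hreflection
    rw [h, (mul_eq_zero.1 hreflection).resolve_right hne, mul_zero, div_zero]
  · have hs0 : Real.Gamma s ≠ 0 :=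
      left_ne_zero_of_mul (hreflection ▸ div_ne_zero Real.pi_ne_zero h)
    rw [eq_div_iff h] at hreflection
    rw [eq_div_iff hs0]
    linear_combination hreflection

theorem im_hookIntegral_hankelFun_of_lt_one {s : ℝ} (hs : s < 1) (P : ℝ) :
    (hookIntegral (hankelFun s) P).im = π / Real.Gamma s := by
  have hb : 0 < 1 - s := sub_pos.2 hs
  obtain ⟨hint, hGamma⟩ := integrable_exp_neg_exp_add_mul_and_integral_eq hb
  have hray := (aecover_Ioi tendsto_id).integral_tendsto_of_countably_generated hint
  have hvertical : Tendsto (fun Q : ℝ => (∫ q in (0 : ℝ)..π, hankelFun s (Q + q * I)).re)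
      atBot (𝓝 0) := by
    have hexponent : Tendsto (fun Q : ℝ => Real.exp Q + (1 - s) * Q) atBot atBot :=
      Real.tendsto_exp_atBot.add_atBot (tendsto_id.const_mul_atBot hb)
    have hzero := (Real.tendsto_exp_atBot.comp hexponent).mul_const |π - 0|
    rw [zero_mul] at hzero
    refine squeeze_zero_norm (fun Q => (Complex.abs_re_le_norm _).trans ?_) hzero
    exact intervalIntegral.norm_integral_le_of_norm_le_const fun q _ => by
      simpa using norm_hankelFun_le s (Q + q * I)
  have hlim := hvertical.add (hray.mul_const (Real.sin ((1 - s) * π)))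
  simp only [id_eq, ← im_hookIntegral_hankelFun_eq_add, im_hookIntegral_hankelFun_eq s _ P] at hlim
  rw [tendsto_nhds_unique tendsto_const_nhds hlim, zero_add, hGamma,
    Gamma_one_sub_mul_sin_eq_pi_div_Gamma hs]

theorem im_hookIntegral_hankelFun_one (P : ℝ) : (hookIntegral (hankelFun 1) P).im = π := by
  have hval : ∀ Q : ℝ, (∫ q in (0 : ℝ)..π, hankelFun 1 (Q + q * I)).re =
      (∫ q in (0 : ℝ)..π, Complex.exp (Real.exp Q * Complex.exp (q * I))).re := fun Q => by
    simp [hankelFun, Complex.exp_add]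
  have hcont : Continuous fun r : ℝ =>
      (∫ q in (0 : ℝ)..π, Complex.exp (r * Complex.exp (q * I))).re :=
    Complex.continuous_re.comp
      (intervalIntegral.continuous_parametric_intervalIntegral_of_continuous' (by fun_prop) _ _)
  have hlim := (hcont.tendsto 0).comp Real.tendsto_exp_atBot
  have hconst : ∀ Q : ℝ, (∫ q in (0 : ℝ)..π, Complex.exp (Real.exp Q * Complex.exp (q * I))).re =
      (hookIntegral (hankelFun 1) P).im := fun Q => by
    rw [← hval, ← im_hookIntegral_hankelFun_eq 1 Q P, im_hookIntegral_hankelFun_eq_add]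
    simp
  simp only [Function.comp_def, hconst] at hlim
  rw [tendsto_nhds_unique tendsto_const_nhds hlim]
  simp

theorem im_hookIntegral_hankelFun_eq_mul (s P : ℝ) :
    (hookIntegral (hankelFun s) P).im = s * (hookIntegral (hankelFun (s + 1)) P).im := by
  obtain ⟨F, hF⟩ := (differentiable_hankelFun (s + 1)).isExactOn_univ
  replace hF : ∀ z, HasDerivAt F (hankelFun (s + 1) z) z := fun z => hF z (mem_univ z)
  have hparts : ∀ z, HasDerivAt (fun z => hankelFun (s + 1) z + s * F z) (hankelFun s z) z := by
    intro z
    have hexponent : HasDerivAt (fun z : ℂ => Complex.exp z - ((s + 1 : ℝ) - 1) * z)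
        (Complex.exp z - ((s + 1 : ℝ) - 1) * 1) z :=
      (Complex.hasDerivAt_exp z).sub ((hasDerivAt_id z).const_mul _)
    refine (hexponent.cexp.add ((hF z).const_mul (s : ℂ))).congr_deriv ?_
    have hshift := hankelFun_add (s + 1) (-1) z
    rw [add_neg_cancel_right] at hshift
    rw [hshift, hankelFun]
    push_cast
    ring_nf
  have hdecay : Tendsto (fun p : ℝ => hankelFun (s + 1) (p + π * I)) atTop (𝓝 0) := by
    refine tendsto_zero_iff_norm_tendsto_zero.2 ?_
    simp only [norm_hankelFun_add_pi_mul_I]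
    refine Real.tendsto_exp_atBot.comp (tendsto_atBot_mono' _ ?_ tendsto_neg_atTop_atBot)
    filter_upwards [eventually_neg_mul_exp_add_mul_le_neg one_pos (1 - (s + 1))] with p hp
    rwa [one_mul] at hp
  have hlim₁ := tendsto_primitive_atTop_add_pi_mul_I (z := P) hF
    (differentiable_hankelFun _).continuous (integrableOn_hankelFun_ray (s + 1) P)
  have hlim₂ := tendsto_primitive_atTop_add_pi_mul_I (z := P) hparts
    (differentiable_hankelFun _).continuous (integrableOn_hankelFun_ray s P)
  have h := congrArg Complex.im
    (tendsto_nhds_unique hlim₂ (hdecay.add (hlim₁.const_mul (s : ℂ))))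
  simp only [Complex.add_im, im_hankelFun_ofReal, Complex.zero_im, Complex.im_ofReal_mul] at h
  linarith

theorem im_hookIntegral_hankelFun (s P : ℝ) :
    (hookIntegral (hankelFun s) P).im = π / Real.Gamma s := by
  have hbounded : ∀ n : ℕ, ∀ s : ℝ, s < n + 1 →
      (hookIntegral (hankelFun s) P).im = π / Real.Gamma s := by
    intro n
    induction n with
    | zero => exact fun s hs => im_hookIntegral_hankelFun_of_lt_one (by simpa using hs) P
    | succ n ih =>
      intro s hs
      rcases eq_or_ne s 1 with rfl | hs1
      · rw [im_hookIntegral_hankelFun_one, Real.Gamma_one, div_one]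
      · have hs0 : s - 1 ≠ 0 := sub_ne_zero.2 hs1
        have hrec := im_hookIntegral_hankelFun_eq_mul (s - 1) P
        have hGamma := Real.Gamma_add_one hs0
        rw [ih (s - 1) (by push_cast at hs; linarith), sub_add_cancel] at hrec
        rw [sub_add_cancel] at hGamma
        rw [hGamma, div_mul_eq_div_div_swap, hrec, mul_div_cancel_left₀ _ hs0]
  obtain ⟨n, hn⟩ := exists_nat_gt s
  exact hbounded n s (by linarith)

end HankelIntegral

section WrightIntegral

open MeasureTheory Set
open Complex (I)
open scoped Real

theorem hasSum_hookIntegral {g : ℕ → ℂ → ℂ} {G S : ℂ → ℂ} {c : ℕ → ℝ} {P : ℝ} (hc : Summable c)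
    (hg : ∀ n, Continuous (g n)) (hG : Continuous G)
    (hray : IntegrableOn (fun p : ℝ => G (p + π * I)) (Ioi P))
    (hbound : ∀ n u, P ≤ u.re → ‖g n u‖ ≤ c n * ‖G u‖)
    (hsum : ∀ u, P ≤ u.re → HasSum (fun n => g n u) (S u)) :
    HasSum (fun n => hookIntegral (g n) P) (hookIntegral S P) := by
  simp only [hookIntegral, Complex.ofReal_re, Complex.ofReal_im,
    intervalIntegral.integral_mul_const]
  refine HasSum.add (HasSum.mul_right _ ?_) ?_
  · refine intervalIntegral.hasSum_integral_of_dominated_convergence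
      (fun n q => c n * ‖G (P + q * I)‖) (fun n => ?_)
      (fun n => Eventually.of_forall fun q _ => hbound n _ (by simp))
      (Eventually.of_forall fun q _ => hc.mul_right _) ?_
      (Eventually.of_forall fun q _ => hsum _ (by simp))
    · exact ((hg n).comp (by fun_prop)).aestronglyMeasurable
    · simp only [tsum_mul_right]
      exact Continuous.intervalIntegrable (by fun_prop) _ _
  · have hmem := ae_restrict_mem (μ := volume) (measurableSet_Ioi (a := P))
    have hre : ∀ p ∈ Ioi P, P ≤ (p + π * I : ℂ).re := fun p hp => by simpa using hp.le
    refine hasSum_integral_of_dominated_convergence (fun n p => c n * ‖G (p + π * I)‖)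
      (fun n => ?_) (fun n => hmem.mono fun p hp => hbound n _ (hre p hp))
      (Eventually.of_forall fun q => hc.mul_right _) ?_
      (hmem.mono fun p hp => hsum _ (hre p hp))
    · exact ((hg n).comp (by fun_prop)).aestronglyMeasurable
    · simp only [tsum_mul_right]
      exact hray.norm.const_mul _

theorem hasSum_pow_mul_hankelFun (lam mu z : ℝ) (u : ℂ) :
    HasSum (fun n : ℕ => ((z ^ n / n.factorial : ℝ) : ℂ) * hankelFun (mu + lam * n) u)
      (Complex.exp (z * Complex.exp (-(lam * u))) * hankelFun mu u) := by
  have hexp := NormedSpace.expSeries_div_hasSum_exp (z * Complex.exp (-(lam * u)))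
  rw [← Complex.exp_eq_exp_ℂ] at hexp
  refine (hexp.mul_right (hankelFun mu u)).congr_fun fun n => ?_
  rw [hankelFun_add, mul_pow, ← Complex.exp_nat_mul]
  push_cast
  ring_nf

theorem norm_pow_mul_hankelFun_le {lam P : ℝ} (hlam : 0 ≤ lam) (mu z : ℝ) (n : ℕ) {u : ℂ}
    (hu : P ≤ u.re) :
    ‖((z ^ n / n.factorial : ℝ) : ℂ) * hankelFun (mu + lam * n) u‖ ≤
      (|z| * Real.exp (-(lam * P))) ^ n / n.factorial * ‖hankelFun mu u‖ := by
  have hexp : ‖Complex.exp (-((lam * n : ℝ) * u))‖ ≤ Real.exp (-(lam * P)) ^ n := by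
    rw [Complex.norm_exp, Complex.neg_re, Complex.re_ofReal_mul, ← Real.exp_nat_mul,
      Real.exp_le_exp]
    nlinarith [mul_nonneg hlam (Nat.cast_nonneg (α := ℝ) n)]
  rw [hankelFun_add, norm_mul, norm_mul, Complex.norm_real, norm_div, norm_pow,
    Real.norm_eq_abs, Real.norm_natCast, mul_pow, mul_div_right_comm, mul_assoc]
  gcongr

theorem wright_eq_im_hookIntegral {lam : ℝ} (hlam : 0 ≤ lam) (mu z P : ℝ) :
    wright lam mu z = 1 / π * (hookIntegral
      (fun u => Complex.exp (z * Complex.exp (-(lam * u))) * hankelFun mu u) P).im := by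
  have hsum := Complex.hasSum_im (hasSum_hookIntegral
    (Real.summable_pow_div_factorial (|z| * Real.exp (-(lam * P))))
    (fun n => (differentiable_hankelFun (mu + lam * n)).continuous.const_mul _)
    (differentiable_hankelFun mu).continuous (integrableOn_hankelFun_ray mu P)
    (fun n u hu => norm_pow_mul_hankelFun_le hlam mu z n hu)
    fun u _ => hasSum_pow_mul_hankelFun lam mu z u)
  simp only [hookIntegral_const_mul, Complex.im_ofReal_mul, im_hookIntegral_hankelFun] at hsum
  rw [← hsum.tsum_eq, wright, ← tsum_mul_left]
  refine tsum_congr fun n => ?_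
  rw [add_comm mu]
  field_simp

theorem differentiable_phase (lam a : ℝ) : Differentiable ℂ (phase lam a) := by
  unfold phase
  fun_prop

theorem wrightMinus_eq_im_hookIntegral {lam x : ℝ} (hlam : 0 ≤ lam) (hx : 0 < x) (a P : ℝ) :
    wrightMinus lam (a * x) x =
      1 / π * (hookIntegral (fun u => Complex.exp (x * phase lam a u)) P).im := by
  have hy : 0 < x / 2 := half_pos hx
  have hlog : Complex.exp (Real.log (x / 2)) = x / 2 := by
    rw [← Complex.ofReal_exp, Real.exp_log hy]
    simp
  have hshift : ∀ u : ℂ,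
      Complex.exp ((-(x / 2) ^ (lam + 1) : ℝ) *
        Complex.exp (-(lam * (u + Real.log (x / 2))))) *
        hankelFun (a * x + 1) (u + Real.log (x / 2)) =
      ((x / 2) ^ (-(a * x)) : ℝ) * Complex.exp (x * phase lam a u) := fun u => by
    have hscale : ((x / 2) ^ (lam + 1) : ℝ) * Complex.exp (-(lam * (u + Real.log (x / 2)))) =
        x / 2 * Complex.exp (-lam * u) := by
      rw [← hlog, Real.rpow_def_of_pos hy, Complex.ofReal_exp, ← Complex.exp_add,
        ← Complex.exp_add]
      push_cast
      ring_nf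
    rw [hankelFun, Complex.ofReal_neg, neg_mul, hscale, Complex.exp_add u, hlog,
      Real.rpow_def_of_pos hy, Complex.ofReal_exp, ← Complex.exp_add, ← Complex.exp_add, phase]
    push_cast
    ring_nf
  rw [wrightMinus, wright_eq_im_hookIntegral hlam _ _ (P + Real.log (x / 2)), Complex.ofReal_add,
    ← hookIntegral_comp_add_ofReal]
  simp only [hshift]
  rw [hookIntegral_const_mul, Complex.im_ofReal_mul, Real.rpow_neg hy.le]
  have := (Real.rpow_pos_of_pos hy (a * x)).ne'
  field_simp

end WrightIntegral

section Phase

open scoped Real ComplexConjugate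

variable {lam a : ℝ} {u : ℂ}

theorem deriv_phase (lam a : ℝ) (u : ℂ) :
    deriv (phase lam a) u = (Complex.exp u + lam * Complex.exp (-lam * u)) / 2 - a := by
  have hexp : HasDerivAt (fun u : ℂ => Complex.exp (-lam * u))
      (Complex.exp (-lam * u) * (-lam * 1)) u := ((hasDerivAt_id u).const_mul _).cexp
  have hphase := (((Complex.hasDerivAt_exp u).sub hexp).div_const 2).sub
    ((hasDerivAt_id u).const_mul (a : ℂ))
  exact hphase.deriv.trans (by ring)

theorem hasDerivAt_deriv_phase (lam a : ℝ) (u : ℂ) :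
    HasDerivAt (deriv (phase lam a)) (phaseSecond lam a u) u := by
  have hdiff : Differentiable ℂ (deriv (phase lam a)) := (differentiable_phase lam a).deriv
  simpa only [phaseSecond, iteratedDeriv_succ, iteratedDeriv_zero] using (hdiff u).hasDerivAt

theorem phaseSecond_eq (lam a : ℝ) (u : ℂ) :
    phaseSecond lam a u = (Complex.exp u - lam ^ 2 * Complex.exp (-lam * u)) / 2 := by
  have hexp : HasDerivAt (fun u : ℂ => Complex.exp (-lam * u))
      (Complex.exp (-lam * u) * (-lam * 1)) u := ((hasDerivAt_id u).const_mul _).cexp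
  have hderiv := (((Complex.hasDerivAt_exp u).add (hexp.const_mul (lam : ℂ))).div_const 2).sub_const
    (a : ℂ)
  refine (hasDerivAt_deriv_phase lam a u).unique ?_
  rw [funext (deriv_phase lam a)]
  exact hderiv.congr_deriv (by ring)

theorem re_phase (lam a : ℝ) (u : ℂ) : (phase lam a u).re =
    (Real.exp u.re * Real.cos u.im - Real.exp (-lam * u.re) * Real.cos (lam * u.im)) / 2
      - a * u.re := by
  simp [phase, Complex.exp_re]

theorem re_deriv_phase (lam a : ℝ) (u : ℂ) : (deriv (phase lam a) u).re =
    (Real.exp u.re * Real.cos u.im + lam * (Real.exp (-lam * u.re) * Real.cos (lam * u.im))) / 2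
      - a := by
  simp [deriv_phase, Complex.exp_re]

theorem im_deriv_phase (lam a : ℝ) (u : ℂ) : (deriv (phase lam a) u).im =
    (Real.exp u.re * Real.sin u.im - lam * (Real.exp (-lam * u.re) * Real.sin (lam * u.im))) / 2 :=
    by
  simp [deriv_phase, Complex.exp_im, ← sub_eq_add_neg]

theorem im_phaseSecond (lam a : ℝ) (u : ℂ) : (phaseSecond lam a u).im =
    (Real.exp u.re * Real.sin u.im +
      lam ^ 2 * (Real.exp (-lam * u.re) * Real.sin (lam * u.im))) / 2 := by
  rw [phaseSecond_eq, ← Complex.ofReal_pow]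
  simp [Complex.exp_im, -Complex.ofReal_pow]

theorem im_phaseSecond_pos (a : ℝ) (hlam : 0 ≤ lam) (h0 : 0 < u.im) (hπ : u.im < π)
    (hlamπ : lam * u.im ≤ π) : 0 < (phaseSecond lam a u).im := by
  rw [im_phaseSecond]
  have := Real.sin_pos_of_pos_of_lt_pi h0 hπ
  have := Real.sin_nonneg_of_nonneg_of_le_pi (mul_nonneg hlam h0.le) hlamπ
  positivity

theorem IsSaddle.conj (hu : IsSaddle lam a u) : IsSaddle lam a (conj u) := by
  have hconj : deriv (phase lam a) (conj u) = conj (deriv (phase lam a) u) := by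
    simp [deriv_phase, ← Complex.exp_conj, Complex.conj_ofNat]
  rw [IsSaddle, hconj, hu, map_zero]

theorem one_add_mul_rpow_le_exp_add_mul_exp (hlam : 0 < lam) (p : ℝ) :
    (1 + lam) * lam ^ ((1 - lam) / (1 + lam)) ≤ Real.exp p + lam * Real.exp (-lam * p) := by
  -- The exponential sum is minimal at `p = 2 log λ / (1 + λ)`, where `e ^ p = λ M`.
  set M := lam ^ ((1 - lam) / (1 + lam))
  obtain ⟨t, rfl⟩ : ∃ t, p = t + 2 * Real.log lam / (1 + lam) :=
    ⟨p - 2 * Real.log lam / (1 + lam), by ring⟩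
  have hM_exp : M = Real.exp (Real.log lam * ((1 - lam) / (1 + lam))) :=
    Real.rpow_def_of_pos hlam _
  have hlam_exp : ∀ s, lam * Real.exp s = Real.exp (Real.log lam + s) := fun s => by
    rw [Real.exp_add, Real.exp_log hlam]
  have hpos : Real.exp (t + 2 * Real.log lam / (1 + lam)) = M * (lam * Real.exp t) := by
    rw [hM_exp, hlam_exp, ← Real.exp_add]
    congr 1
    field_simp
    ring
  have hneg : lam * Real.exp (-lam * (t + 2 * Real.log lam / (1 + lam))) =
      M * Real.exp (-lam * t) := by
    rw [hM_exp, hlam_exp, ← Real.exp_add]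
    congr 1
    field_simp
    ring
  have htangent : 1 + lam ≤ lam * Real.exp t + Real.exp (-lam * t) := by
    linarith [mul_le_mul_of_nonneg_left (Real.add_one_le_exp t) hlam.le,
      Real.add_one_le_exp (-lam * t)]
  rw [hpos, hneg, ← mul_add, mul_comm]
  gcongr

theorem re_deriv_phase_ofReal_pos (hlam : 0 < lam)
    (hbelow : a < (1 + lam) / 2 * lam ^ ((1 - lam) / (1 + lam))) (p : ℝ) :
    0 < (deriv (phase lam a) p).re := by
  have := one_add_mul_rpow_le_exp_add_mul_exp hlam p
  simp only [re_deriv_phase, Complex.ofReal_re, Complex.ofReal_im, Real.cos_zero, mul_zero, mul_one]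
  linarith

end Phase

section Saddles

open Set
open Complex (I)
open scoped Real

variable {lam a q : ℝ} {u : ℂ}

/-- The curve on which `h'` is real, parametrized by the imaginary part `q`. Off `q = 0` the
logarithm is that of `λ sin (λ q) / sin q`; the cardinal sine extends the curve to the real axis. -/
noncomputable def saddleCurve (lam q : ℝ) : ℂ :=
  (Real.log (lam ^ 2 * Real.sinc (lam * q) / Real.sinc q) / (1 + lam) : ℝ) + q * I

theorem re_saddleCurve (lam q : ℝ) : (saddleCurve lam q).re =
    Real.log (lam ^ 2 * Real.sinc (lam * q) / Real.sinc q) / (1 + lam) := by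
  simp [saddleCurve, -Complex.ofReal_div]

theorem im_saddleCurve (lam q : ℝ) : (saddleCurve lam q).im = q := by
  simp [saddleCurve, -Complex.ofReal_div]

theorem sinc_pos_of_nonneg_of_lt_pi {x : ℝ} (h0 : 0 ≤ x) (hπ : x < π) : 0 < Real.sinc x := by
  rcases h0.eq_or_lt with rfl | h0
  · simp
  · rw [Real.sinc_of_ne_zero h0.ne']
    exact div_pos (Real.sin_pos_of_pos_of_lt_pi h0 hπ) h0

theorem continuousAt_saddleCurve (hlam : 0 < lam) (h0 : 0 ≤ q) (hπ : q < π) (hlamπ : lam * q < π) :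
    ContinuousAt (saddleCurve lam) q := by
  have hsinc := sinc_pos_of_nonneg_of_lt_pi h0 hπ
  have hsinc_lam := sinc_pos_of_nonneg_of_lt_pi (mul_nonneg hlam.le h0) hlamπ
  have hquot : ContinuousAt (fun q => lam ^ 2 * Real.sinc (lam * q) / Real.sinc q) q :=
    ContinuousAt.div (by fun_prop) (by fun_prop) hsinc.ne'
  have hlog := (hquot.log (by positivity)).div_const (1 + lam)
  unfold saddleCurve
  fun_prop

theorem differentiableAt_saddleCurve (hlam : 0 < lam) (h0 : 0 < q) (hπ : q < π)
    (hlamπ : lam * q < π) : DifferentiableAt ℝ (saddleCurve lam) q := by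
  have hsinc := sinc_pos_of_nonneg_of_lt_pi h0.le hπ
  have hsinc_lam := sinc_pos_of_nonneg_of_lt_pi (mul_pos hlam h0).le hlamπ
  have hdiff : ∀ x : ℝ, x ≠ 0 → DifferentiableAt ℝ Real.sinc x := fun x hx => by
    rw [Real.sinc_eq_dslope, differentiableAt_dslope_of_ne hx]
    exact Real.differentiableAt_sin
  have hcomp : DifferentiableAt ℝ (fun q => Real.sinc (lam * q)) q :=
    (hdiff _ (mul_pos hlam h0).ne').comp q (by fun_prop)
  have hlog := (((hcomp.const_mul (lam ^ 2)).fun_div (hdiff q h0.ne') hsinc.ne').log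
    (by positivity)).div_const (1 + lam)
  have hre : DifferentiableAt ℝ (fun q : ℝ => (q : ℂ)) q := Complex.ofRealCLM.differentiableAt
  exact (Complex.ofRealCLM.differentiableAt.comp q hlog).add (hre.mul_const I)

theorem im_deriv_phase_eq_zero_iff (a : ℝ) (hlam : 0 < lam) (h0 : 0 < u.im) (hπ : u.im < π)
    (hlamπ : lam * u.im < π) :
    (deriv (phase lam a) u).im = 0 ↔ u = saddleCurve lam u.im := by
  have hsin := Real.sin_pos_of_pos_of_lt_pi h0 hπ
  have hsin_lam := Real.sin_pos_of_pos_of_lt_pi (mul_pos hlam h0) hlamπ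
  have hquot : lam ^ 2 * Real.sinc (lam * u.im) / Real.sinc u.im =
      lam * Real.sin (lam * u.im) / Real.sin u.im := by
    rw [Real.sinc_of_ne_zero h0.ne', Real.sinc_of_ne_zero (mul_pos hlam h0).ne']
    field_simp
  have hexp : Real.exp u.re = Real.exp (-lam * u.re) * Real.exp (u.re * (1 + lam)) := by
    rw [← Real.exp_add]
    ring_nf
  have hcurve : u = saddleCurve lam u.im ↔
      Real.exp (u.re * (1 + lam)) * Real.sin u.im = lam * Real.sin (lam * u.im) := by
    rw [Complex.ext_iff, im_saddleCurve, and_iff_left rfl, re_saddleCurve, hquot,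
      eq_div_iff (by positivity), eq_comm (b := Real.log _),
      ← Real.exp_eq_exp, Real.exp_log (by positivity), eq_comm (b := Real.exp _),
      eq_div_iff hsin.ne']
  rw [im_deriv_phase, hcurve, hexp, div_eq_zero_iff, or_iff_left two_ne_zero, sub_eq_zero,
    mul_left_comm lam, mul_assoc]
  exact mul_right_inj' (Real.exp_pos _).ne'

theorem im_deriv_phase_saddleCurve (a : ℝ) (hlam : 0 < lam) (h0 : 0 < q) (hπ : q < π)
    (hlamπ : lam * q < π) : (deriv (phase lam a) (saddleCurve lam q)).im = 0 := by
  rw [im_deriv_phase_eq_zero_iff a hlam, im_saddleCurve] <;> rwa [im_saddleCurve]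

theorem re_mul_neg_of_im_mul_eq_zero {z w : ℂ} (hz : 0 < z.im) (hw : 0 < w.im)
    (hzw : (z * w).im = 0) : (z * w).re < 0 := by
  rw [Complex.mul_im] at hzw
  rw [Complex.mul_re, sub_neg]
  have : z.im * (z.re * w.re) = -(z.re ^ 2 * w.im) := by linear_combination z.re * hzw
  refine lt_of_mul_lt_mul_left ?_ hz.le
  nlinarith [sq_nonneg z.re, mul_pos (mul_pos hz hz) hw, mul_nonneg (sq_nonneg z.re) hw.le]

theorem deriv_re_deriv_phase_saddleCurve_neg (a : ℝ) (hlam : 0 < lam) (h0 : 0 < q) (hπ : q < π)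
    (hlamπ : lam * q < π) :
    deriv (fun q => (deriv (phase lam a) (saddleCurve lam q)).re) q < 0 := by
  have hcurve := (differentiableAt_saddleCurve hlam h0 hπ hlamπ).hasDerivAt
  have hcomp := (hasDerivAt_deriv_phase lam a (saddleCurve lam q)).comp q hcurve
  have hre := Complex.reCLM.hasFDerivAt.comp_hasDerivAt q hcomp
  have him := Complex.imCLM.hasFDerivAt.comp_hasDerivAt q hcomp
  have him_curve := Complex.imCLM.hasFDerivAt.comp_hasDerivAt q hcurve
  simp only [Function.comp_def, Complex.reCLM_apply, Complex.imCLM_apply, im_saddleCurve]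
    at hre him him_curve
  have hreal : (fun q => (deriv (phase lam a) (saddleCurve lam q)).im) =ᶠ[𝓝 q] fun _ => 0 := by
    have hcont : ContinuousAt (fun q : ℝ => lam * q) q := by fun_prop
    filter_upwards [lt_mem_nhds h0, gt_mem_nhds hπ, hcont.eventually_lt_const hlamπ] with r r0 r1 r2
    exact im_deriv_phase_saddleCurve a hlam r0 r1 r2
  have hone : (deriv (saddleCurve lam) q).im = 1 := him_curve.unique (hasDerivAt_id q)
  rw [hre.deriv]
  refine re_mul_neg_of_im_mul_eq_zero ?_ (hone ▸ one_pos)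
    (him.unique ((hasDerivAt_const q 0).congr_of_eventuallyEq hreal))
  exact im_phaseSecond_pos a hlam.le (by rwa [im_saddleCurve]) (by rwa [im_saddleCurve])
    (by rw [im_saddleCurve]; exact hlamπ.le)

theorem lt_pi_of_le_pi_div (hlam : 0 < lam) (h : q ≤ π / (1 + lam)) : q < π ∧ lam * q < π := by
  rw [le_div_iff₀ (by positivity)] at h
  constructor <;> by_contra! hcon <;> nlinarith [Real.pi_pos]

theorem continuousOn_re_deriv_phase_saddleCurve (a : ℝ) (hlam : 0 < lam) :
    ContinuousOn (fun q => (deriv (phase lam a) (saddleCurve lam q)).re)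
      (Icc 0 (π / (1 + lam))) := by
  intro q hq
  obtain ⟨hπ, hlamπ⟩ := lt_pi_of_le_pi_div hlam hq.2
  exact (Complex.continuous_re.continuousAt.comp
    ((hasDerivAt_deriv_phase lam a _).continuousAt.comp
      (continuousAt_saddleCurve hlam hq.1 hπ hlamπ))).continuousWithinAt

theorem strictAntiOn_re_deriv_phase_saddleCurve (a : ℝ) (hlam : 0 < lam) :
    StrictAntiOn (fun q => (deriv (phase lam a) (saddleCurve lam q)).re)
      (Icc 0 (π / (1 + lam))) := by
  refine strictAntiOn_of_deriv_neg (convex_Icc _ _)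
    (continuousOn_re_deriv_phase_saddleCurve a hlam) fun q hq => ?_
  rw [interior_Icc] at hq
  obtain ⟨hπ, hlamπ⟩ := lt_pi_of_le_pi_div hlam hq.2.le
  exact deriv_re_deriv_phase_saddleCurve_neg a hlam hq.1 hπ hlamπ

theorem re_deriv_phase_saddleCurve_pi_div (a : ℝ) (hlam : 0 < lam) :
    (deriv (phase lam a) (saddleCurve lam (π / (1 + lam)))).re = -a := by
  set q := π / (1 + lam) with hq
  have h0 : 0 < q := by positivity
  obtain ⟨hπ, hlamπ⟩ := lt_pi_of_le_pi_div hlam hq.le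
  have hsum : lam * q = π - q := by
    rw [hq]
    field_simp
    ring
  have hreal := im_deriv_phase_saddleCurve a hlam h0 hπ hlamπ
  rw [im_deriv_phase, im_saddleCurve, hsum, Real.sin_pi_sub] at hreal
  rw [re_deriv_phase, im_saddleCurve, hsum, Real.cos_pi_sub]
  have hexp : Real.exp (saddleCurve lam q).re = lam * Real.exp (-lam * (saddleCurve lam q).re) :=
    mul_right_cancel₀ (Real.sin_pos_of_pos_of_lt_pi h0 hπ).ne' (by linarith)
  rw [hexp]
  ring

theorem isSaddle_iff_saddleCurve (a : ℝ) (hlam : 0 < lam) (h0 : 0 < u.im)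
    (h : u.im < π / (1 + lam)) : IsSaddle lam a u ↔
      u = saddleCurve lam u.im ∧ (deriv (phase lam a) (saddleCurve lam u.im)).re = 0 := by
  obtain ⟨hπ, hlamπ⟩ := lt_pi_of_le_pi_div hlam h.le
  rw [IsSaddle, Complex.ext_iff, Complex.zero_re, Complex.zero_im, and_comm,
    im_deriv_phase_eq_zero_iff a hlam h0 hπ hlamπ]
  exact and_congr_right fun hu => by rw [← hu]

theorem existsUnique_isSaddle_im_lt_pi_div (hlam : 0 < lam) (ha : 0 < a)
    (hbelow : a < (1 + lam) / 2 * lam ^ ((1 - lam) / (1 + lam))) :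
    ∃! u : ℂ, IsSaddle lam a u ∧ 0 < u.im ∧ u.im < π / (1 + lam) := by
  have hstart : 0 < (deriv (phase lam a) (saddleCurve lam 0)).re := by
    have hreal : saddleCurve lam 0 = (saddleCurve lam 0).re :=
      Complex.ext rfl (im_saddleCurve lam 0)
    rw [hreal]
    exact re_deriv_phase_ofReal_pos hlam hbelow _
  have hend : (deriv (phase lam a) (saddleCurve lam (π / (1 + lam)))).re < 0 := by
    rw [re_deriv_phase_saddleCurve_pi_div a hlam]
    exact neg_neg_of_pos ha
  obtain ⟨q, ⟨hq0, hq1⟩, hq⟩ := intermediate_value_Ioo' (by positivity)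
    (continuousOn_re_deriv_phase_saddleCurve a hlam) ⟨hend, hstart⟩
  refine ⟨saddleCurve lam q, ⟨?_, ?_, ?_⟩, fun v ⟨hv, hv0, hv1⟩ => ?_⟩
  · rw [isSaddle_iff_saddleCurve a hlam] <;> rw [im_saddleCurve]
    exacts [⟨rfl, hq⟩, hq0, hq1]
  · rwa [im_saddleCurve]
  · rwa [im_saddleCurve]
  · obtain ⟨hcurve, hzero⟩ := (isSaddle_iff_saddleCurve a hlam hv0 hv1).1 hv
    rw [hcurve, (strictAntiOn_re_deriv_phase_saddleCurve a hlam).injOn ⟨hv0.le, hv1.le⟩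
      ⟨hq0.le, hq1.le⟩ (hzero.trans hq.symm)]

theorem IsUpperSaddle.im_lt_pi_div (h : IsUpperSaddle lam a u) (hlam : 0 < lam) (ha : 0 < a)
    (hbelow : a < (1 + lam) / 2 * lam ^ ((1 - lam) / (1 + lam))) : u.im < π / (1 + lam) := by
  obtain ⟨v, ⟨hv, hv0, hv1⟩, -⟩ := existsUnique_isSaddle_im_lt_pi_div hlam ha hbelow
  have hnearest := h.nearest v hv
  rw [abs_of_pos hv0] at hnearest
  exact (hnearest (lt_pi_of_le_pi_div hlam hv1.le).1.le).trans_lt hv1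

theorem existsUnique_isUpperSaddle (hlam : 0 < lam) (ha : 0 < a)
    (hbelow : a < (1 + lam) / 2 * lam ^ ((1 - lam) / (1 + lam))) :
    ∃! u₀ : ℂ, IsUpperSaddle lam a u₀ := by
  obtain ⟨u, ⟨hu, h0, h1⟩, hunique⟩ := existsUnique_isSaddle_im_lt_pi_div hlam ha hbelow
  have hlowest : ∀ v : ℂ, IsSaddle lam a v → 0 < v.im → u.im ≤ v.im := fun v hv hv0 => by
    rcases lt_or_ge v.im (π / (1 + lam)) with h | h
    · rw [hunique v ⟨hv, hv0, h⟩]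
    · exact h1.le.trans h
  refine ⟨u, ⟨hu, h0, (lt_pi_of_le_pi_div hlam h1.le).1.le, fun v hv _ => ?_⟩, fun v hv =>
    hunique v ⟨hv.saddle, hv.im_pos, hv.im_lt_pi_div hlam ha hbelow⟩⟩
  rcases lt_trichotomy v.im 0 with hneg | hzero | hpos
  · rw [abs_of_neg hneg, ← Complex.conj_im]
    exact hlowest _ hv.conj (by simpa using hneg)
  · have hreal : v = v.re := Complex.ext rfl hzero
    have := re_deriv_phase_ofReal_pos hlam hbelow v.re
    rw [← hreal, hv, Complex.zero_re] at this
    exact absurd this (lt_irrefl 0)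
  · rw [abs_of_pos hpos]
    exact hlowest v hv hpos

end Saddles

section DescentPath

open Set
open Complex (I)
open scoped Real

variable {f : ℂ → ℂ} {u : ℂ} {T : ℝ}

/-- The contour that runs through `u₀` along the diagonal `u₀ + t (1 + i)`, `-Im u₀ ≤ t ≤ T`, then
vertically up to the line `Im u = π` and along that line to `∞ + iπ`, is a path of descent for `f`:
away from `u₀` the real part of `f` is smaller than at `u₀`. -/
structure IsDescentPath (f : ℂ → ℂ) (u₀ : ℂ) (T : ℝ) : Prop where
  pos : 0 < T
  im_add_le : u₀.im + T ≤ π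
  re_diagonal_lt : ∀ t ∈ Icc (-u₀.im) T, t ≠ 0 → (f (u₀ + t * (1 + I))).re < (f u₀).re
  re_vertical_lt : ∀ q ∈ Icc (u₀.im + T) π, (f ((u₀.re + T : ℝ) + q * I)).re < (f u₀).re
  re_ray_le : ∀ p : ℝ, u₀.re + T ≤ p → (f (p + π * I)).re ≤ (f ((u₀.re + T : ℝ) + π * I)).re

theorem add_mul_one_add_I (u : ℂ) (T : ℝ) :
    u + T * (1 + I) = (u.re + T : ℝ) + (u.im + T : ℝ) * I := by
  apply Complex.ext <;> simp

theorem strictAntiOn_re_deriv_diagonal {s : Set ℝ} (hs : Convex ℝ s) (hf : Differentiable ℂ f)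
    (hpos : ∀ t ∈ interior s, 0 < (deriv (deriv f) (u + t * (1 + I))).im) :
    StrictAntiOn (fun t : ℝ => (deriv f (u + t * (1 + I)) * (1 + I)).re) s := by
  have hderiv : ∀ t : ℝ, HasDerivAt (fun t : ℝ => (deriv f (u + t * (1 + I)) * (1 + I)).re)
      (deriv (deriv f) (u + t * (1 + I)) * (1 + I) * (1 + I)).re t := fun t =>
    Complex.reCLM.hasFDerivAt.comp_hasDerivAt t
      ((hasDerivAt_comp_line (hf.deriv _).hasDerivAt).mul_const _)
  refine strictAntiOn_of_deriv_neg hs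
    (fun t _ => (hderiv t).continuousAt.continuousWithinAt) fun t ht => ?_
  rw [(hderiv t).deriv]
  have := hpos t ht
  simp only [Complex.mul_re, Complex.mul_im, Complex.add_re, Complex.add_im, Complex.I_re,
    Complex.I_im, Complex.one_re, Complex.one_im]
  linarith

theorem re_diagonal_lt_of_deriv_eq_zero {s : Set ℝ} (hs : Convex ℝ s) (hf : Differentiable ℂ f)
    (hpos : ∀ t ∈ interior s, 0 < (deriv (deriv f) (u + t * (1 + I))).im) (hu : deriv f u = 0)
    (h0 : (0 : ℝ) ∈ s) {t : ℝ} (ht : t ∈ s) (ht0 : t ≠ 0) :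
    (f (u + t * (1 + I))).re < (f u).re := by
  have hanti := strictAntiOn_re_deriv_diagonal hs hf hpos
  have hcrit : (deriv f (u + (0 : ℝ) * (1 + I)) * (1 + I)).re = 0 := by simp [hu]
  have hderiv : ∀ t : ℝ, HasDerivAt (fun t : ℝ => (f (u + t * (1 + I))).re)
      (deriv f (u + t * (1 + I)) * (1 + I)).re t := fun t =>
    Complex.reCLM.hasFDerivAt.comp_hasDerivAt t (hasDerivAt_comp_line (hf _).hasDerivAt)
  have hcont : Continuous fun t : ℝ => (f (u + t * (1 + I))).re :=
    continuous_iff_continuousAt.2 fun t => (hderiv t).continuousAt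
  have hbase : (f u).re = (f (u + (0 : ℝ) * (1 + I))).re := by simp
  rw [hbase]
  rcases lt_or_gt_of_ne ht0 with hneg | hpos
  · refine strictMonoOn_of_deriv_pos (convex_Icc t 0) hcont.continuousOn (fun r hr => ?_)
      (left_mem_Icc.2 hneg.le) (right_mem_Icc.2 hneg.le) hneg
    rw [interior_Icc] at hr
    rw [(hderiv r).deriv, ← hcrit]
    exact hanti (hs.ordConnected.out ht h0 ⟨hr.1.le, hr.2.le⟩) h0 hr.2
  · refine strictAntiOn_of_deriv_neg (convex_Icc 0 t) hcont.continuousOn (fun r hr => ?_)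
      (left_mem_Icc.2 hpos.le) (right_mem_Icc.2 hpos.le) hpos
    rw [interior_Icc] at hr
    rw [(hderiv r).deriv, ← hcrit]
    exact hanti h0 (hs.ordConnected.out h0 ht ⟨hr.1.le, hr.2.le⟩) hr.1

variable {lam a : ℝ}

theorem im_deriv_deriv_phase_diagonal_pos (a : ℝ) (hlam : 0 ≤ lam) (hπ : u.im + T ≤ π)
    (hlamπ : lam * (u.im + T) ≤ π) :
    ∀ t ∈ interior (Icc (-u.im) T), 0 < (deriv (deriv (phase lam a)) (u + t * (1 + I))).im := by
  intro t ht
  rw [interior_Icc] at ht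
  rw [(hasDerivAt_deriv_phase lam a _).deriv]
  have him : (u + t * (1 + I)).im = u.im + t := by simp
  refine im_phaseSecond_pos a hlam ?_ ?_ ?_ <;> rw [him]
  · linarith [ht.1]
  · linarith [ht.2]
  · exact (mul_le_mul_of_nonneg_left (by linarith [ht.2]) hlam).trans hlamπ

theorem re_phase_ray_le (hlam : 0 ≤ lam) (ha : 0 ≤ a) {p₁ p : ℝ} (hp : p₁ ≤ p)
    (h : (deriv (phase lam a) (p₁ + π * I)).re ≤ 0) :
    (phase lam a (p + π * I)).re ≤ (phase lam a (p₁ + π * I)).re := by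
  have hderiv : ∀ p : ℝ, HasDerivAt (fun p : ℝ => (phase lam a (p + π * I)).re)
      (deriv (phase lam a) (p + π * I)).re p := fun p => by
    have hline :=
      hasDerivAt_comp_line (d := 1) (differentiable_phase lam a (π * I + p * 1)).hasDerivAt
    simp only [mul_one, add_comm (π * I : ℂ)] at hline
    exact Complex.reCLM.hasFDerivAt.comp_hasDerivAt p hline
  have hval : ∀ p : ℝ, (deriv (phase lam a) (p + π * I)).re =
      (-Real.exp p + lam * (Real.exp (-lam * p) * Real.cos (lam * π))) / 2 - a := fun p => by
    rw [re_deriv_phase]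
    simp
  refine antitoneOn_of_deriv_nonpos (convex_Ici p₁)
    (fun s _ => (hderiv s).continuousAt.continuousWithinAt)
    (fun s _ => (hderiv s).differentiableAt.differentiableWithinAt) (fun s hs => ?_)
    self_mem_Ici hp hp
  rw [interior_Ici, mem_Ioi] at hs
  rw [(hderiv s).deriv, hval]
  rw [hval] at h
  rcases le_or_gt 0 (Real.cos (lam * π)) with hcos | hcos
  · have hexp : Real.exp (-lam * s) ≤ Real.exp (-lam * p₁) := Real.exp_le_exp.2 (by nlinarith)
    have := mul_le_mul_of_nonneg_left (mul_le_mul_of_nonneg_right hexp hcos) hlam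
    linarith [Real.exp_le_exp.2 hs.le]
  · have := mul_nonpos_of_nonneg_of_nonpos hlam
      (mul_nonpos_of_nonneg_of_nonpos (Real.exp_pos (-lam * s)).le hcos.le)
    linarith [Real.exp_pos s]

theorem isDescentPath_phase_of_le_one (hlam : 0 ≤ lam) (hlam1 : lam ≤ 1) (ha : 0 ≤ a)
    (hu : IsSaddle lam a u) (h0 : 0 ≤ u.im) (hπ : u.im < π) :
    IsDescentPath (phase lam a) u (π - u.im) := by
  have hlamπ : lam * π ≤ π := mul_le_of_le_one_left Real.pi_pos.le hlam1
  have hzero : (0 : ℝ) ∈ Icc (-u.im) (π - u.im) := ⟨by linarith, by linarith⟩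
  have hend : π - u.im ∈ Icc (-u.im) (π - u.im) := ⟨by linarith [Real.pi_pos], le_rfl⟩
  have hsecond := im_deriv_deriv_phase_diagonal_pos (u := u) (T := π - u.im) a hlam (by simp)
    (by simpa using hlamπ)
  have hdiagonal : ∀ t ∈ Icc (-u.im) (π - u.im), t ≠ 0 →
      (phase lam a (u + t * (1 + I))).re < (phase lam a u).re := fun t ht =>
    re_diagonal_lt_of_deriv_eq_zero (convex_Icc _ _) (differentiable_phase lam a) hsecond hu
      hzero ht
  have hcorner := add_mul_one_add_I u (π - u.im)
  rw [add_sub_cancel] at hcorner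
  refine ⟨by linarith, by simp, hdiagonal, fun q hq => ?_,
    fun p hp => re_phase_ray_le hlam ha hp ?_⟩
  · obtain rfl : q = π := le_antisymm hq.2 (by simpa using hq.1)
    rw [← hcorner]
    exact hdiagonal _ hend (by linarith)
  · have hanti := strictAntiOn_re_deriv_diagonal (convex_Icc _ _) (differentiable_phase lam a)
      hsecond hzero hend (by linarith)
    have hcrit : deriv (phase lam a) u = 0 := hu
    simp only [hcorner, Complex.ofReal_zero, zero_mul, add_zero, hcrit, Complex.zero_re,
      Complex.mul_re, Complex.add_re, Complex.add_im, Complex.one_re, Complex.one_im,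
      Complex.I_re, Complex.I_im, mul_one, zero_add] at hanti
    have him : (deriv (phase lam a) ((u.re + (π - u.im) : ℝ) + π * I)).im ≤ 0 := by
      have hsin := Real.sin_nonneg_of_nonneg_of_le_pi (by positivity) hlamπ
      have : 0 ≤ lam * (Real.exp (-lam * (u.re + (π - u.im))) * Real.sin (lam * π)) := by
        positivity
      rw [im_deriv_phase]
      simp only [Complex.add_re, Complex.add_im, Complex.re_ofReal_mul, Complex.im_ofReal_mul,
        Complex.ofReal_re, Complex.ofReal_im, Complex.I_re, Complex.I_im, mul_zero, mul_one,
        add_zero, zero_add, Real.sin_pi]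
      linarith
    linarith

theorem sin_le_sin_of_add_le_pi {x y : ℝ} (hx : 0 ≤ x) (hxy : x ≤ y) (hsum : x + y ≤ π) :
    Real.sin x ≤ Real.sin y := by
  rcases le_total y (π / 2) with hy | hy
  · exact Real.sin_le_sin_of_le_of_le_pi_div_two (by linarith) hy hxy
  · rw [← Real.sin_pi_sub y]
    exact Real.sin_le_sin_of_le_of_le_pi_div_two (by linarith) (by linarith) (by linarith)

theorem IsSaddle.mul_exp_neg_le_exp (hu : IsSaddle lam a u) (hlam : 1 ≤ lam) (h0 : 0 < u.im)
    (hlt : u.im < π / (1 + lam)) : lam * Real.exp (-lam * u.re) ≤ Real.exp u.re := by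
  have hlam0 := one_pos.trans_le hlam
  have hreal : (deriv (phase lam a) u).im = 0 := by rw [hu, Complex.zero_im]
  rw [im_deriv_phase] at hreal
  have hsum : u.im + lam * u.im ≤ π := by
    rw [lt_div_iff₀ (by positivity)] at hlt
    linarith
  have hsin := sin_le_sin_of_add_le_pi h0.le (le_mul_of_one_le_left h0.le hlam) hsum
  refine le_of_mul_le_mul_right ?_
    (Real.sin_pos_of_pos_of_lt_pi h0 (lt_pi_of_le_pi_div hlam0 hlt.le).1)
  have := mul_le_mul_of_nonneg_left hsin (mul_pos hlam0 (Real.exp_pos (-lam * u.re))).le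
  linarith

theorem re_phase_le_of_im_le (hlam : lam ≠ 0) (a p : ℝ) {q : ℝ} (hq : 0 ≤ π / lam)
    (hle : π / lam ≤ q) (hπ : q ≤ π) :
    (phase lam a (p + q * I)).re ≤ (phase lam a (p + (π / lam : ℝ) * I)).re := by
  have hcos := mul_le_mul_of_nonneg_left (Real.cos_le_cos_of_nonneg_of_le_pi hq hπ hle)
    (Real.exp_pos p).le
  have hcos_lam := mul_le_mul_of_nonneg_left (Real.neg_one_le_cos (lam * q))
    (Real.exp_pos (-lam * p)).le
  simp only [re_phase, Complex.add_re, Complex.add_im, Complex.re_ofReal_mul,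
    Complex.im_ofReal_mul, Complex.ofReal_re, Complex.ofReal_im, Complex.I_re, Complex.I_im,
    mul_zero, mul_one, add_zero, zero_add, mul_div_cancel₀ π hlam, Real.cos_pi]
  linarith

theorem isDescentPath_phase_of_one_le (hlam : 1 ≤ lam) (ha : 0 ≤ a) (hu : IsSaddle lam a u)
    (h0 : 0 < u.im) (hlt : u.im < π / (1 + lam)) :
    IsDescentPath (phase lam a) u (π / lam - u.im) := by
  have hlam0 : 0 < lam := one_pos.trans_le hlam
  have hπ_div : π / lam ≤ π := div_le_self Real.pi_pos.le hlam
  have hpos : 0 < π / lam - u.im := by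
    rw [sub_pos, lt_div_iff₀ hlam0, mul_comm]
    exact (lt_pi_of_le_pi_div hlam0 hlt.le).2
  have hdiagonal : ∀ t ∈ Icc (-u.im) (π / lam - u.im), t ≠ 0 →
      (phase lam a (u + t * (1 + I))).re < (phase lam a u).re := fun t ht =>
    re_diagonal_lt_of_deriv_eq_zero (convex_Icc _ _) (differentiable_phase lam a)
      (im_deriv_deriv_phase_diagonal_pos a hlam0.le (by simpa using hπ_div)
        (by rw [add_sub_cancel, mul_div_cancel₀ _ hlam0.ne'])) hu ⟨by linarith, hpos.le⟩ ht
  refine ⟨hpos, by simpa using hπ_div, hdiagonal, fun q hq => ?_,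
    fun p hp => re_phase_ray_le hlam0.le ha hp ?_⟩
  · rw [add_sub_cancel] at hq
    refine (re_phase_le_of_im_le hlam0.ne' a _ (by positivity) hq.1 hq.2).trans_lt ?_
    have hcorner := add_mul_one_add_I u (π / lam - u.im)
    rw [add_sub_cancel] at hcorner
    rw [← hcorner]
    exact hdiagonal _ ⟨by linarith, le_rfl⟩ hpos.ne'
  · set p₁ := u.re + (π / lam - u.im)
    have hp₁ : u.re ≤ p₁ := by linarith
    have hexp_neg : lam * Real.exp (-lam * p₁) ≤ lam * Real.exp (-lam * u.re) :=
      mul_le_mul_of_nonneg_left (Real.exp_le_exp.2 (by nlinarith)) hlam0.le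
    have hcos := mul_le_mul_of_nonneg_left (Real.cos_le_one (lam * π))
      (mul_pos hlam0 (Real.exp_pos (-lam * p₁))).le
    have hsaddle := hu.mul_exp_neg_le_exp hlam h0 hlt
    simp only [re_deriv_phase, Complex.add_re, Complex.add_im, Complex.re_ofReal_mul,
      Complex.im_ofReal_mul, Complex.ofReal_re, Complex.ofReal_im, Complex.I_re, Complex.I_im,
      mul_zero, mul_one, add_zero, zero_add, Real.cos_pi]
    linarith [Real.exp_le_exp.2 hp₁]

theorem exists_isDescentPath_phase (hlam : 0 < lam) (ha : 0 ≤ a) (hu : IsSaddle lam a u)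
    (h0 : 0 < u.im) (hlt : u.im < π / (1 + lam)) : ∃ T, IsDescentPath (phase lam a) u T := by
  rcases le_total lam 1 with h1 | h1
  · exact ⟨_, isDescentPath_phase_of_le_one hlam.le h1 ha hu h0.le
      (lt_pi_of_le_pi_div hlam hlt.le).1⟩
  · exact ⟨_, isDescentPath_phase_of_one_le h1 ha hu h0 hlt⟩

end DescentPath

section ExponentiallySmallIntegrals

open MeasureTheory Set

theorem isBigO_integral_exp_mul_of_re_le {α : Type*} [MeasurableSpace α] {μ : Measure α}
    {g k : α → ℂ} {η : ℝ} (hint : Integrable (fun t => Complex.exp (g t) * k t) μ)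
    (hη : ∀ᵐ t ∂μ, (g t).re ≤ -η) :
    (fun x : ℝ => ∫ t, Complex.exp (x * g t) * k t ∂μ) =O[atTop] fun x => Real.exp (-η * x) := by
  refine IsBigO.of_bound (Real.exp η * ∫ t, ‖Complex.exp (g t) * k t‖ ∂μ) ?_
  filter_upwards [eventually_ge_atTop 1] with x hx
  have hbound : ∀ᵐ t ∂μ, ‖Complex.exp (x * g t) * k t‖ ≤
      Real.exp (-η * (x - 1)) * ‖Complex.exp (g t) * k t‖ := by
    filter_upwards [hη] with t ht
    have hsplit : (x : ℂ) * g t = ((x - 1 : ℝ) : ℂ) * g t + g t := by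
      push_cast
      ring
    rw [hsplit, Complex.exp_add, mul_assoc, norm_mul, Complex.norm_exp, Complex.re_ofReal_mul]
    exact mul_le_mul_of_nonneg_right (Real.exp_le_exp.2 (by nlinarith)) (norm_nonneg _)
  refine (norm_integral_le_of_norm_le (hint.norm.const_mul _) hbound).trans_eq ?_
  rw [integral_const_mul, Real.norm_of_nonneg (Real.exp_pos _).le, mul_right_comm, ← Real.exp_add]
  ring_nf

theorem exists_isBigO_intervalIntegral_exp_mul {g k : ℝ → ℂ} {a b : ℝ} (hab : a ≤ b)
    (hg : ContinuousOn g (Icc a b)) (hk : ContinuousOn k (Icc a b))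
    (hneg : ∀ t ∈ Icc a b, (g t).re < 0) :
    ∃ η > 0, (fun x : ℝ => ∫ t in a..b, Complex.exp (x * g t) * k t) =O[atTop]
      fun x => Real.exp (-η * x) := by
  obtain ⟨m, hm, hmax⟩ := isCompact_Icc.exists_isMaxOn (nonempty_Icc.2 hab)
    (Complex.continuous_re.comp_continuousOn hg)
  refine ⟨-(g m).re, neg_pos.2 (hneg m hm), ?_⟩
  simp only [intervalIntegral.integral_of_le hab]
  refine isBigO_integral_exp_mul_of_re_le
    ((hg.cexp.mul hk).integrableOn_Icc.mono_set Ioc_subset_Icc_self) ?_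
  filter_upwards [ae_restrict_mem measurableSet_Ioc] with t ht
  rw [neg_neg]
  exact hmax (Ioc_subset_Icc_self ht)

theorem isBigO_exp_neg_mul_rpow {η : ℝ} (hη : 0 < η) (s : ℝ) :
    (fun x : ℝ => Real.exp (-η * x)) =O[atTop] fun x => x ^ s :=
  (isLittleO_exp_neg_mul_rpow_atTop hη s).isBigO

end ExponentiallySmallIntegrals

section GaussianLaplace

open MeasureTheory Set
open scoped Real

theorem norm_exp_mul_neg_sq_div_two (x w : ℝ) :
    ‖Complex.exp (x * -((w : ℂ) ^ 2 / 2))‖ = Real.exp (-(x / 2) * |w| ^ 2) := by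
  rw [Complex.norm_exp, Complex.re_ofReal_mul, sq_abs]
  norm_cast
  ring_nf

theorem integrable_abs_pow_mul_exp_neg_sq (n : ℕ) {x : ℝ} (hx : 0 < x) :
    Integrable fun w : ℝ => |w| ^ n * Real.exp (-(x / 2) * |w| ^ 2) := by
  have hrpow := integrable_rpow_mul_exp_neg_mul_sq (half_pos hx) (s := n)
    (by linarith [n.cast_nonneg (α := ℝ)])
  simpa only [Real.rpow_natCast, norm_mul, norm_pow, Real.norm_eq_abs, Real.abs_exp, sq_abs]
    using hrpow.norm

theorem integral_abs_pow_mul_exp_neg_sq (n : ℕ) {x : ℝ} (hx : 0 < x) :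
    ∫ w : ℝ, |w| ^ n * Real.exp (-(x / 2) * |w| ^ 2) =
      (x / 2) ^ (-(((n : ℝ) + 1) / 2)) * Real.Gamma ((n + 1) / 2) := by
  have hhalf := integral_rpow_mul_exp_neg_mul_rpow (p := 2) (q := n) two_pos
    (by linarith [n.cast_nonneg (α := ℝ)]) (half_pos hx)
  simp only [Real.rpow_natCast, Real.rpow_two] at hhalf
  rw [integral_comp_abs (f := fun w : ℝ => w ^ n * Real.exp (-(x / 2) * w ^ 2)), hhalf]
  ring_nf

theorem isBigO_integral_gaussian_mul {g : ℝ → ℂ} {C : ℝ} {n : ℕ}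
    (hg : ∀ w, ‖g w‖ ≤ C * |w| ^ n) :
    (fun x : ℝ => ∫ w : ℝ, Complex.exp (x * -((w : ℂ) ^ 2 / 2)) * g w) =O[atTop]
      fun x : ℝ => x ^ (-(((n : ℝ) + 1) / 2)) := by
  refine IsBigO.of_bound
    (C * (Real.Gamma ((n + 1) / 2) * 2⁻¹ ^ (-(((n : ℝ) + 1) / 2)))) ?_
  filter_upwards [eventually_gt_atTop 0] with x hx
  refine (norm_integral_le_of_norm_le ((integrable_abs_pow_mul_exp_neg_sq n hx).const_mul C)
    (Eventually.of_forall fun w => ?_)).trans_eq ?_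
  · rw [norm_mul, norm_exp_mul_neg_sq_div_two, ← mul_assoc, mul_comm]
    exact mul_le_mul_of_nonneg_right (hg w) (Real.exp_pos _).le
  · rw [integral_const_mul, integral_abs_pow_mul_exp_neg_sq n hx, div_eq_mul_inv x,
      Real.mul_rpow hx.le (by positivity), Real.norm_of_nonneg (by positivity)]
    ring

theorem integrable_gaussian_mul_pow (n : ℕ) {x : ℝ} (hx : 0 < x) :
    Integrable fun w : ℝ => Complex.exp (x * -((w : ℂ) ^ 2 / 2)) * (w : ℂ) ^ n := by
  refine (integrable_norm_iff (by fun_prop)).1 ?_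
  refine (integrable_abs_pow_mul_exp_neg_sq n hx).congr (Eventually.of_forall fun w => ?_)
  simp only [norm_mul, norm_exp_mul_neg_sq_div_two, norm_pow, Complex.norm_real, Real.norm_eq_abs,
    mul_comm]

theorem integral_gaussian_mul_odd_pow (k : ℕ) (x : ℝ) :
    ∫ w : ℝ, Complex.exp (x * -((w : ℂ) ^ 2 / 2)) * (w : ℂ) ^ (2 * k + 1) = 0 := by
  have hneg := integral_neg_eq_self
    (fun w : ℝ => Complex.exp (x * -((w : ℂ) ^ 2 / 2)) * (w : ℂ) ^ (2 * k + 1)) volume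
  simp only [Complex.ofReal_neg, Odd.neg_pow ⟨k, rfl⟩, neg_sq, mul_neg, integral_neg] at hneg ⊢
  exact self_eq_neg.1 hneg.symm

theorem ofReal_Gamma_nat_add_half (k : ℕ) :
    (Real.Gamma (k + 1 / 2) : ℂ) = (ascPochhammer ℂ k).eval (1 / 2) * √π := by
  have hhalf : ∀ m : ℕ, (1 / 2 : ℂ) ≠ -m := fun m h => by
    have := congrArg Complex.re h
    norm_num at this
    linarith [m.cast_nonneg (α := ℝ)]
  have hsqrt : (√π : ℂ) = Complex.Gamma (1 / 2) := by
    rw [← Real.Gamma_one_half_eq, ← Complex.Gamma_ofReal]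
    norm_num
  rw [← Complex.Gamma_add_nat_div_Gamma_eq _ hhalf, hsqrt, div_mul_cancel₀, ← Complex.Gamma_ofReal]
  · push_cast
    rw [add_comm]
  · exact Complex.Gamma_ne_zero hhalf

theorem integral_gaussian_mul_even_pow (k : ℕ) {x : ℝ} (hx : 0 < x) :
    ∫ w : ℝ, Complex.exp (x * -((w : ℂ) ^ 2 / 2)) * (w : ℂ) ^ (2 * k) =
      √(2 * π / x) * ((ascPochhammer ℂ k).eval (1 / 2) * (2 / x) ^ k) := by
  have hreal : ∀ w : ℝ, Complex.exp (x * -((w : ℂ) ^ 2 / 2)) * (w : ℂ) ^ (2 * k) =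
      ((|w| ^ (2 * k) * Real.exp (-(x / 2) * |w| ^ 2) : ℝ) : ℂ) := fun w => by
    rw [sq_abs, (even_two_mul k).pow_abs]
    push_cast
    ring_nf
  have hexponent : ((2 * k : ℕ) + 1 : ℝ) / 2 = k + 1 / 2 := by
    push_cast
    ring
  have hpow : (x / 2) ^ (-((k : ℝ) + 1 / 2)) = (2 / x) ^ k * √(2 / x) := by
    rw [Real.rpow_neg (by positivity), ← Real.inv_rpow (by positivity), inv_div,
      Real.rpow_add (by positivity), Real.rpow_natCast, Real.sqrt_eq_rpow]
  have hsqrt : √(2 * π / x) = √(2 / x) * √π := by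
    rw [← Real.sqrt_mul (by positivity)]
    ring_nf
  simp only [hreal]
  rw [integral_complex_ofReal, integral_abs_pow_mul_exp_neg_sq _ hx, hexponent, hpow, hsqrt,
    Complex.ofReal_mul, ofReal_Gamma_nat_add_half]
  push_cast
  ring

/-- The first `N` terms of the asymptotic expansion of `∫ exp (-x w² / 2) f w dw` as `x → +∞`,
for a small interval of integration around `0`: the Gaussian moments of the even part of the Taylor
series of `f` at `0`. -/
noncomputable def laplaceExpansion (f : ℂ → ℂ) (N : ℕ) (x : ℝ) : ℂ :=
  √(2 * π / x) * ∑ k ∈ Finset.range N,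
    (ascPochhammer ℂ k).eval (1 / 2) * (iteratedDeriv (2 * k) f 0 / ((2 * k).factorial : ℂ)) *
      (2 / (x : ℂ)) ^ k

theorem integral_gaussian_mul_sum (f : ℂ → ℂ) (N : ℕ) {x : ℝ} (hx : 0 < x) :
    ∫ w : ℝ, Complex.exp (x * -((w : ℂ) ^ 2 / 2)) *
      ∑ j ∈ Finset.range (2 * N), iteratedDeriv j f 0 / (j.factorial : ℂ) * (w : ℂ) ^ j =
      laplaceExpansion f N x := by
  simp only [Finset.mul_sum, laplaceExpansion, mul_left_comm (Complex.exp _)]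
  rw [integral_finsetSum _ fun j _ => (integrable_gaussian_mul_pow j hx).const_mul _]
  simp only [integral_const_mul]
  induction N with
  | zero => simp only [mul_zero, Finset.range_zero, Finset.sum_empty]
  | succ N ih =>
    rw [mul_add_one, Finset.sum_range_succ, Finset.sum_range_succ, ih, Finset.sum_range_succ,
      integral_gaussian_mul_odd_pow, integral_gaussian_mul_even_pow N hx]
    ring

theorem exists_eventually_norm_sub_sum_le {f : ℂ → ℂ} (hf : AnalyticAt ℂ f 0) (n : ℕ) :
    ∃ C, ∀ᶠ z in 𝓝 (0 : ℂ),
      ‖f z - ∑ j ∈ Finset.range n, iteratedDeriv j f 0 / (j.factorial : ℂ) * z ^ j‖ ≤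
        C * ‖z‖ ^ n := by
  obtain ⟨F, hF, hTaylor⟩ := hf.exists_eq_sum_add_pow_mul n
  obtain ⟨C, hC⟩ := hF.continuousAt.norm.isBoundedUnder_le
  refine ⟨C, (eventually_map.1 hC).mono fun z hz => ?_⟩
  have hremainder : f z - ∑ j ∈ Finset.range n, iteratedDeriv j f 0 / (j.factorial : ℂ) * z ^ j =
      z ^ n * F z := by
    rw [hTaylor z, sub_eq_iff_eq_add', smul_eq_mul]
    exact congrArg (· + _) (Finset.sum_congr rfl fun j _ => by rw [smul_eq_mul]; ring)
  rw [hremainder, norm_mul, norm_pow, mul_comm]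
  exact mul_le_mul_of_nonneg_right hz (by positivity)

theorem exists_norm_sum_mul_pow_le (c : ℕ → ℂ) (n : ℕ) {r : ℝ} (hr : 0 < r) :
    ∃ C, ∀ z : ℂ, r ≤ ‖z‖ → ‖∑ j ∈ Finset.range n, c j * z ^ j‖ ≤ C * ‖z‖ ^ n := by
  refine ⟨∑ j ∈ Finset.range n, ‖c j‖ * r⁻¹ ^ (n - j), fun z hz => ?_⟩
  have hone : 1 ≤ r⁻¹ * ‖z‖ := by rwa [inv_mul_eq_div, one_le_div hr]
  rw [Finset.sum_mul]
  refine norm_sum_le_of_le _ fun j hj => ?_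
  have hj : j ≤ n := (Finset.mem_range.1 hj).le
  rw [norm_mul, norm_pow, mul_assoc]
  gcongr
  calc ‖z‖ ^ j ≤ (r⁻¹ * ‖z‖) ^ (n - j) * ‖z‖ ^ j :=
        le_mul_of_one_le_left (by positivity) (one_le_pow₀ hone)
    _ = r⁻¹ ^ (n - j) * ‖z‖ ^ n := by rw [mul_pow, mul_assoc, ← pow_add, Nat.sub_add_cancel hj]

theorem eventually_exists_norm_indicator_sub_sum_le {f : ℂ → ℂ} (hf : AnalyticAt ℂ f 0) (n : ℕ) :
    ∀ᶠ r in 𝓝[>] (0 : ℝ), ∃ C, ∀ w : ℝ, ‖(Ioc (-r) r).indicator (fun w : ℝ => f w) w -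
      ∑ j ∈ Finset.range n, iteratedDeriv j f 0 / (j.factorial : ℂ) * (w : ℂ) ^ j‖ ≤
        C * |w| ^ n := by
  obtain ⟨C, hC⟩ := exists_eventually_norm_sub_sum_le hf n
  obtain ⟨r₀, hr₀, hC⟩ := Metric.eventually_nhds_iff_ball.1 hC
  filter_upwards [Ioo_mem_nhdsGT hr₀] with r hr
  obtain ⟨D, hD⟩ := exists_norm_sum_mul_pow_le
    (fun j => iteratedDeriv j f 0 / (j.factorial : ℂ)) n hr.1
  refine ⟨max C D, fun w => ?_⟩
  have hnorm : ‖(w : ℂ)‖ = |w| := by simp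
  by_cases hw : w ∈ Ioc (-r) r
  · rw [indicator_of_mem hw, ← hnorm]
    refine (hC w ?_).trans (by gcongr; exact le_max_left _ _)
    rw [mem_ball_zero_iff, hnorm]
    exact (abs_le.2 ⟨hw.1.le, hw.2⟩).trans_lt hr.2
  · rw [indicator_of_notMem hw, zero_sub, norm_neg, ← hnorm]
    refine (hD w ?_).trans (by gcongr; exact le_max_right _ _)
    rw [hnorm]
    by_contra! hlt
    exact hw ⟨(abs_lt.1 hlt).1, (abs_lt.1 hlt).2.le⟩

theorem eventually_continuousOn_ofReal {f : ℂ → ℂ} (hf : AnalyticAt ℂ f 0) :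
    ∀ᶠ r in 𝓝[>] (0 : ℝ), ContinuousOn (fun w : ℝ => f w) (Icc (-r) r) := by
  obtain ⟨r₀, hr₀, hball⟩ := Metric.eventually_nhds_iff_ball.1 hf.eventually_analyticAt
  filter_upwards [Ioo_mem_nhdsGT hr₀] with r hr w hw
  have hw : (w : ℂ) ∈ Metric.ball (0 : ℂ) r₀ := by
    rw [mem_ball_zero_iff, Complex.norm_real, Real.norm_eq_abs]
    exact (abs_le.2 hw).trans_lt hr.2
  exact ((hball w hw).continuousAt.comp (f := fun w : ℝ => (w : ℂ))
    Complex.continuous_ofReal.continuousAt).continuousWithinAt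

theorem isBigO_integral_gaussian_sub_laplaceExpansion {f : ℂ → ℂ} (hf : AnalyticAt ℂ f 0) (N : ℕ) :
    ∀ᶠ r in 𝓝[>] (0 : ℝ),
      (fun x : ℝ => (∫ w in -r..r, Complex.exp (x * -((w : ℂ) ^ 2 / 2)) * f w) -
        laplaceExpansion f N x) =O[atTop] fun x : ℝ => x ^ (-(N : ℝ) - 1 / 2) := by
  -- Cutting off `f` but not its Taylor polynomial turns the error into one Gaussian integral over
  -- the line, whose integrand is dominated by `|w| ^ (2 N)`.
  filter_upwards [eventually_exists_norm_indicator_sub_sum_le hf (2 * N),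
    eventually_continuousOn_ofReal hf, self_mem_nhdsWithin] with r ⟨C, hC⟩ hcont hr
  have hexponent : -(((2 * N : ℕ) + 1 : ℝ) / 2) = -(N : ℝ) - 1 / 2 := by
    push_cast
    ring
  rw [← hexponent]
  refine (isBigO_integral_gaussian_mul hC).congr' ?_ EventuallyEq.rfl
  filter_upwards [eventually_gt_atTop 0] with x hx
  have hcutoff : Integrable ((Ioc (-r) r).indicator
      fun w : ℝ => Complex.exp (x * -((w : ℂ) ^ 2 / 2)) * f w) :=
    ((ContinuousOn.mul (by fun_prop) hcont).integrableOn_Icc.mono_set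
      Ioc_subset_Icc_self).integrable_indicator measurableSet_Ioc
  have hpolynomial : Integrable fun w : ℝ => Complex.exp (x * -((w : ℂ) ^ 2 / 2)) *
      ∑ j ∈ Finset.range (2 * N), iteratedDeriv j f 0 / (j.factorial : ℂ) * (w : ℂ) ^ j := by
    simp only [Finset.mul_sum, mul_left_comm (Complex.exp _)]
    exact integrable_finsetSum _ fun j _ => (integrable_gaussian_mul_pow j hx).const_mul _
  rw [← integral_gaussian_mul_sum f N hx,
    intervalIntegral.integral_of_le (neg_le_self (mem_Ioi.1 hr).le),
    ← integral_indicator measurableSet_Ioc, ← integral_sub hcutoff hpolynomial]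
  congr 1 with w
  rw [mul_sub, indicator_mul_right]

end GaussianLaplace

section MorseCharts

open Set

variable {f φ : ℂ → ℂ} {u₀ d : ℂ}

/-- `φ` is a local coordinate `u = φ w` around `u₀ = φ 0` in which `f - f u₀` becomes `-w² / 2`. -/
structure IsMorseChart (f : ℂ → ℂ) (u₀ : ℂ) (φ : ℂ → ℂ) : Prop where
  analytic : AnalyticAt ℂ φ 0
  map_zero : φ 0 = u₀
  deriv_ne_zero : deriv φ 0 ≠ 0
  eventually_eq : ∀ᶠ w in 𝓝 (0 : ℂ), f (φ w) - f u₀ = -(w ^ 2 / 2)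

theorem sq_complexSqrt (z : ℂ) : Complex.sqrt z ^ 2 = z := by
  rw [Complex.sqrt]
  exact_mod_cast Complex.cpow_nat_inv_pow z two_ne_zero

theorem exists_analyticAt_sub_eq_neg_sq_div_two {s : ℂ} (hf : AnalyticAt ℂ f u₀)
    (hcrit : deriv f u₀ = 0) (hs : s ^ 2 = -iteratedDeriv 2 f u₀) (hs0 : s ≠ 0) :
    ∃ S : ℂ → ℂ, AnalyticAt ℂ S u₀ ∧ S u₀ = 0 ∧ deriv S u₀ = s ∧
      ∀ u, f u - f u₀ = -(S u ^ 2 / 2) := by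
  have hshift : AnalyticAt ℂ (fun z => f (u₀ + z)) 0 :=
    AnalyticAt.comp (by rwa [add_zero]) (by fun_prop)
  obtain ⟨F, hF, hTaylor⟩ := hshift.exists_eq_sum_add_pow_mul 3
  have hTaylor : ∀ z, f (u₀ + z) = f u₀ - s ^ 2 * z ^ 2 / 2 + z ^ 3 * F z := fun z => by
    rw [hTaylor z]
    simp only [Finset.sum_range_succ, Finset.sum_range_zero, iteratedDeriv_comp_const_add,
      iteratedDeriv_zero, iteratedDeriv_one, add_zero, hcrit, hs, smul_eq_mul]
    push_cast [Nat.factorial]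
    ring
  set q : ℂ → ℂ := fun u => Complex.sqrt (1 - 2 * (u - u₀) * F (u - u₀) / s ^ 2) with hq
  have hq1 : q u₀ = 1 := by simp [hq]
  have hqan : AnalyticAt ℂ q u₀ := by
    have hbase : AnalyticAt ℂ (fun u => 1 - 2 * (u - u₀) * F (u - u₀) / s ^ 2) u₀ := by
      have : AnalyticAt ℂ (fun u => F (u - u₀)) u₀ :=
        AnalyticAt.comp (by rwa [sub_self]) (by fun_prop)
      exact analyticAt_const.sub ((AnalyticAt.mul (by fun_prop) this).div_const)
    exact hbase.cpow analyticAt_const (by simp)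
  refine ⟨fun u => (u - u₀) * (s * q u), by fun_prop, by simp, ?_, fun u => ?_⟩
  · have hderiv := ((hasDerivAt_id' u₀).sub_const u₀).fun_mul
      (hqan.differentiableAt.hasDerivAt.const_mul s)
    simpa [hq1] using hderiv.deriv
  · have := hTaylor (u - u₀)
    rw [add_sub_cancel] at this
    rw [this, mul_pow, mul_pow, sq_complexSqrt]
    field_simp
    ring

theorem exists_isMorseChart {s : ℂ} (hf : AnalyticAt ℂ f u₀) (hcrit : deriv f u₀ = 0)
    (hs : s ^ 2 = -iteratedDeriv 2 f u₀) (hs0 : s ≠ 0) :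
    ∃ φ, IsMorseChart f u₀ φ ∧ deriv φ 0 = 1 / s := by
  obtain ⟨S, hS, hS0, rfl, hsq⟩ := exists_analyticAt_sub_eq_neg_sq_div_two hf hcrit hs hs0
  have hstrict := hS.hasStrictDerivAt
  have hanalytic := hS.analyticAt_localInverse hs0
  have hderiv := (hstrict.to_localInverse hs0).hasDerivAt.deriv
  have hmap := (hstrict.hasStrictFDerivAt_equiv hs0).localInverse_apply_image
  have hinv := hstrict.eventually_right_inverse hs0
  rw [hS0] at hanalytic hderiv hmap hinv
  rw [← one_div] at hderiv
  refine ⟨_, ⟨hanalytic, hmap, hderiv ▸ one_div_ne_zero hs0, ?_⟩, hderiv⟩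
  filter_upwards [hinv] with w hw
  rw [hsq, hw]

theorem IsMorseChart.eventually_exists_eq_add_mul (hφ : IsMorseChart f u₀ φ) {U : Set ℂ}
    (hU : IsOpen U) (hd : d / deriv φ 0 ∈ U) {V : Set ℂ} (hV : V ∈ 𝓝 0) :
    ∀ᶠ t : ℝ in 𝓝[≠] 0, ∃ z ∈ U, t * z ∈ V ∧ φ (t * z) = u₀ + t * d := by
  have hstrict := hφ.analytic.hasStrictDerivAt
  have hderiv := (hstrict.to_localInverse hφ.deriv_ne_zero).hasDerivAt
  have hmap := (hstrict.hasStrictFDerivAt_equiv hφ.deriv_ne_zero).localInverse_apply_image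
  have hinv := hstrict.eventually_right_inverse hφ.deriv_ne_zero
  rw [hφ.map_zero] at hderiv hmap hinv
  set ψ := hstrict.localInverse φ (deriv φ 0) 0 hφ.deriv_ne_zero
  replace hmap : ψ u₀ = 0 := hmap
  have hline : Tendsto (fun t : ℝ => u₀ + t * d) (𝓝 0) (𝓝 u₀) :=
    Continuous.tendsto' (by fun_prop) _ _ (by simp)
  have hψ : Tendsto (fun t : ℝ => ψ (u₀ + t * d)) (𝓝 0) (𝓝 0) :=
    hmap ▸ hderiv.continuousAt.tendsto.comp hline
  have hslope : Tendsto (fun t : ℝ => ψ (u₀ + t * d) / t) (𝓝[≠] 0) (𝓝 (d / deriv φ 0)) := by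
    have hderivLine : HasDerivAt (fun t : ℝ => ψ (u₀ + t * d)) ((deriv φ 0)⁻¹ * d) 0 :=
      hasDerivAt_comp_line (by simpa using hderiv)
    simpa [slope_fun_def, hmap, div_eq_inv_mul] using hderivLine.tendsto_slope
  filter_upwards [hslope.eventually (hU.mem_nhds hd), (hψ.eventually hV).filter_mono inf_le_left,
    (hline.eventually hinv).filter_mono inf_le_left, self_mem_nhdsWithin] with t hUt hVt hinvt ht
  have hmul : t * (ψ (u₀ + t * d) / t) = ψ (u₀ + t * d) :=
    mul_div_cancel₀ _ (Complex.ofReal_ne_zero.2 ht)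
  exact ⟨_, hUt, by rwa [hmul], by rwa [hmul]⟩

end MorseCharts

section SaddlePoint

open MeasureTheory Set

variable {f φ : ℂ → ℂ} {u₀ d : ℂ}

theorem exists_isBigO_sub_of_hasDerivAt_exp_mul {G : ℝ → ℂ → ℂ} {g k : ℂ → ℂ} {s : Set ℂ}
    {z₁ z₂ : ℂ} (hs : Convex ℝ s) (h₁ : z₁ ∈ s) (h₂ : z₂ ∈ s) (hg : ContinuousOn g s)
    (hk : ContinuousOn k s) (hneg : ∀ z ∈ s, (g z).re < 0)
    (hG : ∀ x, ∀ z ∈ s, HasDerivAt (G x) (Complex.exp (x * g z) * k z) z) :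
    ∃ η > 0, (fun x => G x z₂ - G x z₁) =O[atTop] fun x => Real.exp (-η * x) := by
  have hsub := hs.segment_subset h₁ h₂
  have hcompact : IsCompact (segment ℝ z₁ z₂) :=
    segment_eq_image_lineMap ℝ z₁ z₂ ▸ isCompact_Icc.image AffineMap.lineMap_continuous
  obtain ⟨m, hm, hmax⟩ := hcompact.exists_isMaxOn ⟨z₁, left_mem_segment ℝ z₁ z₂⟩
    (Complex.continuous_re.comp_continuousOn (hg.mono hsub))
  obtain ⟨K, hK⟩ := hcompact.exists_bound_of_continuousOn (hk.mono hsub)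
  refine ⟨-(g m).re, neg_pos.2 (hneg m (hsub hm)), IsBigO.of_bound (K * ‖z₂ - z₁‖) ?_⟩
  filter_upwards [eventually_ge_atTop 0] with x hx
  rw [neg_neg, Real.norm_of_nonneg (Real.exp_pos _).le, mul_right_comm]
  refine (convex_segment z₁ z₂).norm_image_sub_le_of_norm_hasDerivWithin_le
    (fun z hz => (hG x z (hsub hz)).hasDerivWithinAt) (fun z hz => ?_)
    (left_mem_segment ℝ z₁ z₂) (right_mem_segment ℝ z₁ z₂)
  have hre : (g z).re ≤ (g m).re := hmax hz
  rw [norm_mul, Complex.norm_exp, Complex.re_ofReal_mul, mul_comm x, mul_comm K]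
  exact mul_le_mul (Real.exp_le_exp.2 (by gcongr)) (hK z hz) (norm_nonneg _) (Real.exp_pos _).le

/-- The cone `|arg w| < π / 4`, on which `exp (-w² / 2)` decays. -/
def gaussianCone : Set ℂ := {w | |w.im| < w.re}

theorem isOpen_gaussianCone : IsOpen gaussianCone :=
  isOpen_lt (by fun_prop) (by fun_prop)

theorem convex_gaussianCone : Convex ℝ gaussianCone := by
  rw [convex_iff_forall_pos]
  intro z hz w hw a b ha hb _
  simp only [gaussianCone, mem_ofPred_eq, abs_lt, Complex.add_im, Complex.add_re, Complex.smul_im,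
    Complex.smul_re, smul_eq_mul] at hz hw ⊢
  constructor <;> nlinarith

theorem ofReal_mul_mem_gaussianCone {r : ℝ} (hr : 0 < r) {w : ℂ} (hw : w ∈ gaussianCone) :
    r * w ∈ gaussianCone := by
  simp only [gaussianCone, mem_ofPred_eq, Complex.re_ofReal_mul, Complex.im_ofReal_mul, abs_mul,
    abs_of_pos hr] at hw ⊢
  exact mul_lt_mul_of_pos_left hw hr

theorem re_neg_sq_div_two_neg {w : ℂ} (hw : w ∈ gaussianCone ∪ -gaussianCone) :
    (-(w ^ 2 / 2)).re < 0 := by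
  have habs : |w.im| < |w.re| := by
    rcases hw with hw | hw
    · exact hw.trans_le (le_abs_self _)
    · rw [Set.mem_neg, gaussianCone, mem_ofPred_eq, Complex.neg_im, Complex.neg_re, abs_neg] at hw
      exact hw.trans_le (neg_le_abs _)
  have hsq := sq_lt_sq.2 habs
  rw [Complex.neg_re, Complex.div_ofNat_re, sq w, Complex.mul_re]
  linarith

theorem isBigO_primitive_sub_of_subset_gaussianCone {G : ℝ → ℂ → ℂ} {k : ℂ → ℂ} {s : Set ℂ}
    (hs : Convex ℝ s) (hcone : s ⊆ gaussianCone ∪ -gaussianCone) (hk : ContinuousOn k s)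
    (hG : ∀ x : ℝ, ∀ w ∈ s, HasDerivAt (G x) (Complex.exp (x * -(w ^ 2 / 2)) * k w) w) {z w : ℂ}
    (hz : z ∈ s) (hw : w ∈ s) (p : ℝ) :
    (fun x => G x w - G x z) =O[atTop] fun x => x ^ p :=
  have ⟨_, hη, hO⟩ := exists_isBigO_sub_of_hasDerivAt_exp_mul hs hz hw (by fun_prop) hk
    (fun _ hw => re_neg_sq_div_two_neg (hcone hw)) hG
  hO.trans (isBigO_exp_neg_mul_rpow hη p)

theorem isBigO_primitive_sub_laplaceExpansion {G : ℝ → ℂ → ℂ} {k : ℂ → ℂ} {ρ : ℝ}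
    (hk : AnalyticOnNhd ℂ k (Metric.ball 0 ρ)) (hG : ∀ x : ℝ, ∀ w ∈ Metric.ball (0 : ℂ) ρ,
      HasDerivAt (G x) (Complex.exp (x * -(w ^ 2 / 2)) * k w) w) {z₁ z₂ : ℂ}
    (h₁ : z₁ ∈ Metric.ball 0 ρ ∩ gaussianCone) (h₂ : z₂ ∈ Metric.ball 0 ρ ∩ gaussianCone) (N : ℕ) :
    (fun x => G x z₂ - G x (-z₁) - laplaceExpansion k N x) =O[atTop]
      fun x => x ^ (-(N : ℝ) - 1 / 2) := by
  have hρ : 0 < ρ := Metric.pos_of_mem_ball h₁.1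
  have hk0 : AnalyticAt ℂ k 0 := hk 0 (Metric.mem_ball_self hρ)
  obtain ⟨r, ⟨hlaplace, hcont⟩, hr0, hrρ⟩ :=
    (((isBigO_integral_gaussian_sub_laplaceExpansion hk0 N).and
      (eventually_continuousOn_ofReal hk0)).and (Ioo_mem_nhdsGT hρ)).exists
  have hconvex : Convex ℝ (Metric.ball (0 : ℂ) ρ ∩ gaussianCone) :=
    (convex_ball _ _).inter convex_gaussianCone
  have hr : (r : ℂ) ∈ Metric.ball (0 : ℂ) ρ ∩ gaussianCone :=
    ⟨by simpa [abs_of_pos hr0] using hrρ, by simpa [gaussianCone] using hr0⟩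
  have hright := isBigO_primitive_sub_of_subset_gaussianCone hconvex
    (fun w hw => Or.inl hw.2) (hk.continuousOn.mono inter_subset_left)
    (fun x w hw => hG x w hw.1) hr h₂ (-(N : ℝ) - 1 / 2)
  have hball : ∀ w ∈ -(Metric.ball (0 : ℂ) ρ ∩ gaussianCone), w ∈ Metric.ball (0 : ℂ) ρ :=
    fun w hw => by simpa using hw.1
  have hleft := isBigO_primitive_sub_of_subset_gaussianCone hconvex.neg
    (fun w hw => Or.inr hw.2) (hk.continuousOn.mono hball) (fun x w hw => hG x w (hball w hw))
    (neg_mem_neg.2 h₁) (neg_mem_neg.2 hr) (-(N : ℝ) - 1 / 2)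
  have hmiddle : ∀ x : ℝ, ∫ w in -r..r, Complex.exp (x * -((w : ℂ) ^ 2 / 2)) * k w =
      G x r - G x (-r) := fun x => by
    rw [← Complex.ofReal_neg]
    have hIcc := uIcc_of_le (neg_le_self hr0.le)
    refine intervalIntegral.integral_eq_sub_of_hasDerivAt (f := fun w : ℝ => G x w)
      (fun w hw => (hG x w ?_).comp_ofReal)
      (ContinuousOn.intervalIntegrable (ContinuousOn.mul (by fun_prop) (hIcc ▸ hcont)))
    rw [mem_ball_zero_iff, Complex.norm_real, Real.norm_eq_abs]
    exact (abs_le.2 (mem_Icc.1 (hIcc ▸ hw))).trans_lt hrρ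
  refine ((hright.add hleft).add hlaplace).congr_left fun x => ?_
  rw [hmiddle]
  ring

theorem IsMorseChart.isBigO_integral_line_sub_laplaceExpansion (hφ : IsMorseChart f u₀ φ)
    (hf : Differentiable ℂ f) (hd : d / deriv φ 0 ∈ gaussianCone) (N : ℕ) :
    ∀ᶠ ε in 𝓝[>] (0 : ℝ),
      (fun x : ℝ => (∫ t in -ε..ε, Complex.exp (x * (f (u₀ + t * d) - f u₀)) * d) -
        laplaceExpansion (deriv φ) N x) =O[atTop] fun x => x ^ (-(N : ℝ) - 1 / 2) := by
  have hprimitive : ∀ x : ℝ, ∃ F, ∀ z, HasDerivAt F (Complex.exp (x * (f z - f u₀))) z := fun x =>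
    have ⟨F, hF⟩ := Differentiable.isExactOn_univ
      (f := fun z => Complex.exp (x * (f z - f u₀))) (by fun_prop)
    ⟨F, fun z => hF z (mem_univ z)⟩
  choose F hF using hprimitive
  obtain ⟨ρ, hρ, hball⟩ := Metric.eventually_nhds_iff_ball.1
    (hφ.eventually_eq.and hφ.analytic.eventually_analyticAt)
  have hG : ∀ x : ℝ, ∀ w ∈ Metric.ball (0 : ℂ) ρ,
      HasDerivAt (fun w => F x (φ w)) (Complex.exp (x * -(w ^ 2 / 2)) * deriv φ w) w := by
    intro x w hw
    rw [← (hball w hw).1]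
    exact (hF x (φ w)).comp w (hball w hw).2.differentiableAt.hasDerivAt
  have hline := hφ.eventually_exists_eq_add_mul isOpen_gaussianCone hd (Metric.ball_mem_nhds 0 hρ)
  have hneg : Tendsto (fun t : ℝ => -t) (𝓝[>] 0) (𝓝[≠] 0) := by
    simpa using (tendsto_neg_nhdsGT (a := (0 : ℝ))).mono_right (nhdsLT_le_nhdsNE _)
  filter_upwards [hline.filter_mono (nhdsGT_le_nhdsNE 0), hneg.eventually hline,
    self_mem_nhdsWithin] with ε ⟨z₂, hcone₂, hball₂, hφ₂⟩ ⟨z₁, hcone₁, hball₁, hφ₁⟩ hε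
  have hdiagonal := fun x => integral_line_eq_sub (hF x)
    (by have := hf.continuous; fun_prop) u₀ d (-ε) ε
  simp only [hdiagonal, ← hφ₁, ← hφ₂]
  simp only [Complex.ofReal_neg, neg_mul] at hball₁ ⊢
  exact isBigO_primitive_sub_laplaceExpansion (G := fun x w => F x (φ w))
    (fun w hw => (hball w hw).2.deriv) hG
    ⟨by simpa using hball₁, ofReal_mul_mem_gaussianCone hε hcone₁⟩
    ⟨hball₂, ofReal_mul_mem_gaussianCone hε hcone₂⟩ N

end SaddlePoint

section SteepestDescent

open MeasureTheory Set
open Complex (I)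
open scoped Real

variable {f φ : ℂ → ℂ} {u₀ : ℂ} {T : ℝ}

theorem IsDescentPath.isBigO_hookIntegral (h : IsDescentPath f u₀ T) (hf : Continuous f)
    (hray : IntegrableOn (fun p : ℝ => Complex.exp (f (p + π * I))) (Ioi (u₀.re + T))) (s : ℝ) :
    (fun x : ℝ => hookIntegral (fun u => Complex.exp (x * (f u - f u₀))) (u₀ + T * (1 + I)))
      =O[atTop] fun x => x ^ s := by
  obtain ⟨η, hη, hvertical⟩ := exists_isBigO_intervalIntegral_exp_mul h.im_add_le
    (g := fun q => f ((u₀.re + T : ℝ) + q * I) - f u₀) (k := fun _ => I) (by fun_prop)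
    (by fun_prop) fun q hq => by simpa using h.re_vertical_lt q hq
  have hcorner : 0 < (f u₀).re - (f ((u₀.re + T : ℝ) + π * I)).re :=
    sub_pos.2 (h.re_vertical_lt π (right_mem_Icc.2 h.im_add_le))
  have hhorizontal := isBigO_integral_exp_mul_of_re_le (μ := volume.restrict (Ioi (u₀.re + T)))
    (g := fun p : ℝ => f (p + π * I) - f u₀) (k := fun _ => 1)
    (η := (f u₀).re - (f ((u₀.re + T : ℝ) + π * I)).re)
    (by simpa only [Complex.exp_sub, mul_one] using hray.div_const _)
    (by
      filter_upwards [ae_restrict_mem measurableSet_Ioi] with p hp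
      rw [Complex.sub_re]
      linarith [h.re_ray_le p (mem_Ioi.1 hp).le])
  refine ((hvertical.trans (isBigO_exp_neg_mul_rpow hη s)).add
    (hhorizontal.trans (isBigO_exp_neg_mul_rpow hcorner s))).congr_left fun x => ?_
  simp only [hookIntegral, add_mul_one_add_I, Complex.add_re, Complex.add_im, Complex.mul_re,
    Complex.mul_im, Complex.ofReal_re, Complex.ofReal_im, Complex.I_re, Complex.I_im, mul_one,
    mul_zero, sub_zero, add_zero, zero_add]

theorem IsDescentPath.isBigO_diagonal (h : IsDescentPath f u₀ T) (hf : Continuous f)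
    (h0 : 0 < u₀.im) (s : ℝ) :
    ∀ᶠ ε in 𝓝[>] (0 : ℝ), (fun x : ℝ =>
      (∫ t in -u₀.im..T, Complex.exp (x * (f (u₀ + t * (1 + I)) - f u₀)) * (1 + I)) -
        ∫ t in -ε..ε, Complex.exp (x * (f (u₀ + t * (1 + I)) - f u₀)) * (1 + I))
      =O[atTop] fun x => x ^ s := by
  filter_upwards [Ioo_mem_nhdsGT (lt_min h0 h.pos)] with ε hε
  have hεim : ε < u₀.im := hε.2.trans_le (min_le_left _ _)
  have hεT : ε < T := hε.2.trans_le (min_le_right _ _)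
  have houter : ∀ a b : ℝ, a ≤ b → Icc a b ⊆ Icc (-u₀.im) T \ {0} → (fun x : ℝ =>
      ∫ t in a..b, Complex.exp (x * (f (u₀ + t * (1 + I)) - f u₀)) * (1 + I)) =O[atTop]
        fun x => x ^ s := fun a b hab hsub => by
    obtain ⟨η, hη, hO⟩ := exists_isBigO_intervalIntegral_exp_mul hab
      (g := fun t => f (u₀ + t * (1 + I)) - f u₀) (k := fun _ => 1 + I) (by fun_prop)
      (by fun_prop) fun t ht => by
        simpa using h.re_diagonal_lt t (hsub ht).1 (hsub ht).2
    exact hO.trans (isBigO_exp_neg_mul_rpow hη s)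
  refine ((houter (-u₀.im) (-ε) (by linarith) fun t ht => ?_).add
    (houter ε T hεT.le fun t ht => ?_)).congr_left fun x => ?_
  · exact ⟨⟨ht.1, by linarith [ht.2, hε.1]⟩, (ht.2.trans_lt (neg_neg_of_pos hε.1)).ne⟩
  · exact ⟨⟨by linarith [ht.1, hε.1], ht.2⟩, (hε.1.trans_le ht.1).ne'⟩
  · have hint : ∀ a b : ℝ, IntervalIntegrable
        (fun t : ℝ => Complex.exp (x * (f (u₀ + t * (1 + I)) - f u₀)) * (1 + I)) volume a b :=
      fun a b => Continuous.intervalIntegrable (by fun_prop) a b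
    rw [← intervalIntegral.integral_add_adjacent_intervals (hint (-u₀.im) (-ε)) (hint (-ε) T),
      ← intervalIntegral.integral_add_adjacent_intervals (hint (-ε) ε) (hint ε T)]
    ring

theorem IsDescentPath.isBigO_hookIntegral_sub_laplaceExpansion (h : IsDescentPath f u₀ T)
    (hf : Differentiable ℂ f) (h0 : 0 < u₀.im) (hφ : IsMorseChart f u₀ φ)
    (hd : (1 + I) / deriv φ 0 ∈ gaussianCone)
    (hray : ∀ x : ℝ, 0 < x → ∀ P,
      IntegrableOn (fun p : ℝ => Complex.exp (x * f (p + π * I))) (Ioi P)) (N : ℕ) :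
    (fun x : ℝ => hookIntegral (fun u => Complex.exp (x * (f u - f u₀))) (u₀.re - u₀.im : ℝ) -
      laplaceExpansion (deriv φ) N x) =O[atTop] fun x => x ^ (-(N : ℝ) - 1 / 2) := by
  obtain ⟨ε, hsaddle, hdiagonal⟩ := ((hφ.isBigO_integral_line_sub_laplaceExpansion hf hd N).and
    (h.isBigO_diagonal hf.continuous h0 (-(N : ℝ) - 1 / 2))).exists
  have hhook := h.isBigO_hookIntegral hf.continuous
    (by simpa using hray 1 one_pos (u₀.re + T)) (-(N : ℝ) - 1 / 2)
  refine ((hsaddle.add hdiagonal).add hhook).congr' ?_ EventuallyEq.rfl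
  filter_upwards [eventually_gt_atTop 0] with x hx
  have hdeform := integral_segment_add_hookIntegral
    (f := fun u => Complex.exp (x * (f u - f u₀))) (by fun_prop)
    (fun P => by
      simp only [mul_sub, Complex.exp_sub]
      exact (hray x hx P).div_const _)
    u₀ (1 + I) (-u₀.im) T
  have hbase : u₀ + (-u₀.im : ℝ) * (1 + I) = (u₀.re - u₀.im : ℝ) := by
    rw [add_mul_one_add_I]
    simp [sub_eq_add_neg]
  rw [hbase] at hdeform
  rw [← hdeform]
  ring

theorem integrableOn_exp_mul_phase_ray {lam x : ℝ} (hlam : 0 ≤ lam) (hx : 0 < x) (a P : ℝ) :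
    IntegrableOn (fun p : ℝ => Complex.exp (x * phase lam a (p + π * I))) (Ioi P) := by
  have hcont := (differentiable_phase lam a).continuous
  refine ((integrableOn_exp_neg_mul_exp_add_mul (half_pos hx) (-(a * x)) P).const_mul
    (Real.exp (x / 2 * Real.exp (-lam * P)))).mono'
    (Continuous.aestronglyMeasurable (by fun_prop)) ?_
  filter_upwards [ae_restrict_mem measurableSet_Ioi] with p hp
  have hre : (p + π * I : ℂ).re = p := by simp
  have him : (p + π * I : ℂ).im = π := by simp
  have hexp : Real.exp (-lam * p) ≤ Real.exp (-lam * P) :=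
    Real.exp_le_exp.2 (by nlinarith [mem_Ioi.1 hp])
  have hcos : -Real.exp (-lam * P) ≤ Real.exp (-lam * p) * Real.cos (lam * π) := by
    nlinarith [Real.neg_one_le_cos (lam * π), Real.exp_pos (-lam * p)]
  rw [Complex.norm_exp, Complex.re_ofReal_mul, ← Real.exp_add, Real.exp_le_exp, re_phase, hre, him,
    Real.cos_pi]
  linarith [mul_le_mul_of_nonneg_left hcos hx.le]

end SteepestDescent

section SquareRoots

open Complex (I)

variable {z : ℂ}

theorem re_complexSqrt_nonneg (z : ℂ) : 0 ≤ (Complex.sqrt z).re := by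
  rw [Complex.sqrt, Complex.cpow_inv_two_re]
  exact Real.sqrt_nonneg _

theorem re_complexSqrt_neg_pos (hz : 0 < z.im) : 0 < (Complex.sqrt (-z)).re := by
  refine (re_complexSqrt_nonneg _).lt_of_ne fun h => ?_
  have him := congrArg Complex.im (sq_complexSqrt (-z))
  rw [sq, Complex.mul_im, ← h, Complex.neg_im] at him
  linarith

theorem im_complexSqrt_neg_neg (hz : 0 < z.im) : (Complex.sqrt (-z)).im < 0 := by
  have him := congrArg Complex.im (sq_complexSqrt (-z))
  rw [sq, Complex.mul_im, Complex.neg_im] at him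
  nlinarith [re_complexSqrt_neg_pos hz]

theorem complexSqrt_neg_ne_zero (hz : 0 < z.im) : Complex.sqrt (-z) ≠ 0 := fun h =>
  (re_complexSqrt_neg_pos hz).ne' (by rw [h, Complex.zero_re])

theorem complexSqrt_eq_I_mul_complexSqrt_neg (hz : 0 < z.im) :
    Complex.sqrt z = I * Complex.sqrt (-z) := by
  have hsq : Complex.sqrt z ^ 2 = (I * Complex.sqrt (-z)) ^ 2 := by
    rw [mul_pow, sq_complexSqrt, sq_complexSqrt, Complex.I_sq, neg_mul_neg, one_mul]
  refine (sq_eq_sq_iff_eq_or_eq_neg.1 hsq).resolve_right fun h => ?_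
  have hre := re_complexSqrt_nonneg z
  rw [h, Complex.neg_re, Complex.I_mul_re, neg_neg] at hre
  exact hre.not_gt (im_complexSqrt_neg_neg hz)

theorem one_add_I_mul_complexSqrt_neg_mem_gaussianCone (hz : 0 < z.im) :
    (1 + I) * Complex.sqrt (-z) ∈ gaussianCone := by
  have hre := re_complexSqrt_neg_pos hz
  have him := im_complexSqrt_neg_neg hz
  simp only [gaussianCone, Set.mem_ofPred_eq, Complex.mul_re, Complex.mul_im, Complex.add_re,
    Complex.add_im, Complex.one_re, Complex.one_im, Complex.I_re, Complex.I_im, abs_lt]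
  constructor <;> linarith

end SquareRoots

section WrightAsymptotics

open Complex (I)
open scoped Real

variable {lam a : ℝ} {u₀ : ℂ} {φ : ℂ → ℂ}

theorem IsSaddleInversion.isMorseChart (hφ : IsSaddleInversion lam a u₀ φ)
    (him : 0 < (phaseSecond lam a u₀).im) : IsMorseChart (phase lam a) u₀ φ where
  analytic := hφ.analytic
  map_zero := hφ.map_zero
  deriv_ne_zero := hφ.deriv_zero ▸ one_div_ne_zero (complexSqrt_neg_ne_zero him)
  eventually_eq := hφ.phase_eq.mono fun _ h => h.symm

theorem IsSaddle.exists_isSaddleInversion (hu : IsSaddle lam a u₀)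
    (him : 0 < (phaseSecond lam a u₀).im) : ∃ φ, IsSaddleInversion lam a u₀ φ := by
  obtain ⟨φ, hφ, hderiv⟩ := exists_isMorseChart ((differentiable_phase lam a).analyticAt u₀) hu
    (sq_complexSqrt _) (complexSqrt_neg_ne_zero him)
  exact ⟨φ, hφ.analytic, hφ.map_zero, hderiv, hφ.eventually_eq.mono fun _ h => h.symm⟩

theorem laplaceExpansion_deriv_eq_saddlePartialSum (him : 0 < (phaseSecond lam a u₀).im)
    (φ : ℂ → ℂ) (N : ℕ) (x : ℝ) :
    laplaceExpansion (deriv φ) N x = √(2 * π / x) *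
      (saddlePartialSum (saddleCoeff lam a u₀ φ) N x / Complex.sqrt (-phaseSecond lam a u₀)) := by
  rw [laplaceExpansion, saddlePartialSum, Finset.sum_div]
  congr 1
  refine Finset.sum_congr rfl fun k _ => ?_
  have hs := complexSqrt_neg_ne_zero him
  have hsign : ((-1 : ℂ) ^ k) * (-1) ^ k = 1 := by rw [← mul_pow, neg_one_mul, neg_neg, one_pow]
  rw [saddleCoeff, ← inv_div (x : ℂ) 2, inv_pow, eq_div_iff hs]
  linear_combination -(ascPochhammer ℂ k).eval (1 / 2) * Complex.sqrt (-phaseSecond lam a u₀) *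
    (iteratedDeriv (2 * k) (deriv φ) 0 / ((2 * k).factorial : ℂ)) / ((x : ℂ) / 2) ^ k * hsign

theorem im_mul_laplaceExpansion_deriv (him : 0 < (phaseSecond lam a u₀).im) (φ : ℂ → ℂ) (N : ℕ)
    {x : ℝ} (hx : 0 < x) (E : ℂ) :
    1 / π * (E * laplaceExpansion (deriv φ) N x).im =
      √(2 / (π * x)) * (E / Complex.sqrt (phaseSecond lam a u₀) *
        saddlePartialSum (saddleCoeff lam a u₀ φ) N x).re := by
  have hsqrt : √(2 / (π * x)) = 1 / π * √(2 * π / x) := by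
    have hsq : 2 / (π * x) = (1 / π) ^ 2 * (2 * π / x) := by field_simp
    rw [hsq, Real.sqrt_mul (by positivity), Real.sqrt_sq (by positivity)]
  have hrotate : ∀ s z : ℂ, E / (I * s) * z = -I * (E * (z / s)) := fun s z => by
    rw [← div_div, Complex.div_I]
    ring
  rw [laplaceExpansion_deriv_eq_saddlePartialSum him, hsqrt,
    complexSqrt_eq_I_mul_complexSqrt_neg him, hrotate, mul_left_comm E, Complex.im_ofReal_mul,
    neg_mul, Complex.neg_re, Complex.I_mul_re, neg_neg, mul_assoc]

theorem wrightMinus_sub_eq_im (hlam : 0 ≤ lam) (him : 0 < (phaseSecond lam a u₀).im) (φ : ℂ → ℂ)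
    (N : ℕ) (P : ℝ) {x : ℝ} (hx : 0 < x) :
    wrightMinus lam (a * x) x - √(2 / (π * x)) *
      (Complex.exp (x * phase lam a u₀) / Complex.sqrt (phaseSecond lam a u₀) *
        saddlePartialSum (saddleCoeff lam a u₀ φ) N x).re =
      1 / π * (Complex.exp (x * phase lam a u₀) *
        (hookIntegral (fun u => Complex.exp (x * (phase lam a u - phase lam a u₀))) P -
          laplaceExpansion (deriv φ) N x)).im := by
  rw [wrightMinus_eq_im_hookIntegral hlam hx a P, ← im_mul_laplaceExpansion_deriv him φ N hx,
    mul_sub, Complex.sub_im, mul_sub, ← hookIntegral_const_mul]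
  simp only [← Complex.exp_add, ← mul_add, add_sub_cancel]

theorem IsSaddleInversion.isBigO_wrightMinus_sub (hφ : IsSaddleInversion lam a u₀ φ)
    (hlam : 0 ≤ lam) (h0 : 0 < u₀.im) (him : 0 < (phaseSecond lam a u₀).im) {T : ℝ}
    (hpath : IsDescentPath (phase lam a) u₀ T) (N : ℕ) :
    (fun x : ℝ => wrightMinus lam (a * x) x - √(2 / (π * x)) *
      (Complex.exp (x * phase lam a u₀) / Complex.sqrt (phaseSecond lam a u₀) *
        saddlePartialSum (saddleCoeff lam a u₀ φ) N x).re)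
      =O[atTop] fun x => Real.exp (x * (phase lam a u₀).re) * x ^ (-(N : ℝ) - 1 / 2) := by
  have hdir : (1 + I) / deriv φ 0 ∈ gaussianCone := by
    rw [hφ.deriv_zero, div_div_eq_mul_div, div_one]
    exact one_add_I_mul_complexSqrt_neg_mem_gaussianCone him
  have hexpansion := hpath.isBigO_hookIntegral_sub_laplaceExpansion (differentiable_phase lam a) h0
    (hφ.isMorseChart him) hdir (fun x hx P => integrableOn_exp_mul_phase_ray hlam hx a P) N
  have hexp : (fun x : ℝ => Complex.exp (x * phase lam a u₀)) =O[atTop]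
      fun x => Real.exp (x * (phase lam a u₀).re) :=
    isBigO_of_le _ fun x => by
      rw [Complex.norm_exp, Complex.re_ofReal_mul, Real.norm_of_nonneg (Real.exp_pos _).le]
  refine (((Complex.imCLM.isBigO_comp _ _).trans (hexp.mul hexpansion)).const_mul_left
    (1 / π)).congr' ?_ EventuallyEq.rfl
  filter_upwards [eventually_gt_atTop 0] with x hx
  exact (wrightMinus_sub_eq_im hlam him φ N _ hx).symm

end WrightAsymptotics

theorem mainTheorem2 (lam a : ℝ) (hlam : 0 < lam) (ha : 0 < a)
    (hbelow : a < (1 + lam) / 2 * lam ^ ((1 - lam) / (1 + lam))) :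
    (∃! u₀ : ℂ, IsUpperSaddle lam a u₀) ∧
    ∀ u₀ : ℂ, IsUpperSaddle lam a u₀ →
      phaseSecond lam a u₀ ≠ 0 ∧
      (∃ φ : ℂ → ℂ, IsSaddleInversion lam a u₀ φ) ∧
      ∀ φ : ℂ → ℂ, IsSaddleInversion lam a u₀ φ →
        ∀ N : ℕ,
          (fun x : ℝ => wrightMinus lam (a * x) x -
            Real.sqrt (2 / (Real.pi * x)) *
              (Complex.exp (x * phase lam a u₀) / Complex.sqrt (phaseSecond lam a u₀) *
                saddlePartialSum (saddleCoeff lam a u₀ φ) N x).re)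
          =O[atTop]
          (fun x : ℝ => Real.exp (x * (phase lam a u₀).re) * x ^ (-(N : ℝ) - 1 / 2)) := by
  refine ⟨existsUnique_isUpperSaddle hlam ha hbelow, fun u₀ hu => ?_⟩
  have hlt := hu.im_lt_pi_div hlam ha hbelow
  obtain ⟨hπ, hlamπ⟩ := lt_pi_of_le_pi_div hlam hlt.le
  have him := im_phaseSecond_pos a hlam.le hu.im_pos hπ hlamπ.le
  obtain ⟨T, hpath⟩ := exists_isDescentPath_phase hlam ha.le hu.saddle hu.im_pos hlt
  exact ⟨fun h => him.ne' (by rw [h, Complex.zero_im]), hu.saddle.exists_isSaddleInversion him,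
    fun φ hφ N => hφ.isBigO_wrightMinus_sub hlam.le hu.im_pos him hpath N⟩
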